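/- Let $\mathfrak{s}$ be the Schrödinger Lie algebra over $\mathbb{C}$, with basis $e,h,f,p,q,z$, where $z$ is central and $$[h,e]=2e,\quad [h,f]=-2f,\quad [e,f]=h,\quad [e,p]=0,\quad [h,p]=p,\quad [f,p]=q,\quad [e,q]=p,\quad [h,q]=-q,\quad [f,q]=0,\quad [p,q]=z.$$ Let $U=U(\mathfrak{s})$ be its universal enveloping algebra, with center $Z(\mathfrak{s})$. For $\lambda_1,\lambda_2\in\mathbb{C}$ let $\Delta(\lambda_1,\lambda_2)=U\otimes_{U(\mathfrak{b})}\mathbb{C}_\lambda$ be the Verma module, where $\mathfrak{b}=\operatorname{span}\{h,z,e,p\}$ and $\mathbb{C}_\lambda$ is the one-dimensional $\mathfrak{b}$-module on which $h$ acts as $\lambda_1$, $z$ as $\lambda_2$, and $e,p$ act as $0$. Let $U_{(f)}$ be the localization of $U$ at the powers of $f$, and let $S_f=U_{(f)}/U$, a $U$-$U$-bimodule. For a $U$-module $M$ let $\operatorname{EnAr}(M)$ be the $U$-submodule of $S_f\otimes_U M$ consisting of all $m$ with $\dim\mathbb{C}[e]m<\infty$. For $n\in\mathbb{Z}_{\ge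 0}$ and $\lambda_2\in\mathbb{C}\setminus\{0\}$ put $V(n,\lambda_2)=\operatorname{EnAr}(\Delta(n-1,\lambda_2))$. **Corollary.** Suppose $n\in\mathbb{Z}_{\ge 0}$ and $\lambda_2\in\mathbb{C}\setminus\{0\}$. Then the annihilators in $U$ satisfy $$\operatorname{Ann}(V(n,\lambda_2))=\operatorname{Ann}(\Delta(n-1,\lambda_2))=\operatorname{Ann}(\Delta(-n-2,\lambda_2)),$$ and this ideal $I$ is centrally generated, that is, it is generated by $I\cap Z(\mathfrak{s})$. -/

import Mathlib

open scoped TensorProduct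

namespace Schroedinger

attribute [local instance] LieRing.ofAssociativeRing

/-! ## The Schrödinger Lie algebra -/

/-- The underlying space of the Schrödinger Lie algebra over `ℂ`: the element `⟨a, b, c, u, v, w⟩`
is the linear combination `a e + b h + c f + u p + v q + w z` of the basis `e, h, f, p, q, z`. -/
@[ext] structure Sch where
  e : ℂ
  h : ℂ
  f : ℂ
  p : ℂ
  q : ℂ
  z : ℂ

namespace Sch

instance : Zero Sch := ⟨⟨0, 0, 0, 0, 0, 0⟩⟩
instance : Add Sch := ⟨fun x y => ⟨x.e + y.e, x.h + y.h, x.f + y.f, x.p + y.p, x.q + y.q, x.z + y.z⟩⟩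
instance : Neg Sch := ⟨fun x => ⟨-x.e, -x.h, -x.f, -x.p, -x.q, -x.z⟩⟩
instance : SMul ℂ Sch := ⟨fun c x => ⟨c * x.e, c * x.h, c * x.f, c * x.p, c * x.q, c * x.z⟩⟩

/-- The bracket, extended bilinearly from
`[e,f] = h`, `[h,e] = 2e`, `[h,f] = -2f`, `[e,p] = 0`, `[h,p] = p`, `[f,p] = q`,
`[e,q] = p`, `[h,q] = -q`, `[f,q] = 0`, `[p,q] = z`, with `z` central. -/
instance : Bracket Sch Sch := ⟨fun x y =>
  { e := 2 * (x.h * y.e - x.e * y.h)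
    h := x.e * y.f - x.f * y.e
    f := -2 * (x.h * y.f - x.f * y.h)
    p := (x.h * y.p - x.p * y.h) + (x.e * y.q - x.q * y.e)
    q := -(x.h * y.q - x.q * y.h) + (x.f * y.p - x.p * y.f)
    z := x.p * y.q - x.q * y.p }⟩

@[simp] theorem zero_e : (0 : Sch).e = 0 := rfl
@[simp] theorem zero_h : (0 : Sch).h = 0 := rfl
@[simp] theorem zero_f : (0 : Sch).f = 0 := rfl
@[simp] theorem zero_p : (0 : Sch).p = 0 := rfl
@[simp] theorem zero_q : (0 : Sch).q = 0 := rfl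
@[simp] theorem zero_z : (0 : Sch).z = 0 := rfl
@[simp] theorem add_e (x y : Sch) : (x + y).e = x.e + y.e := rfl
@[simp] theorem add_h (x y : Sch) : (x + y).h = x.h + y.h := rfl
@[simp] theorem add_f (x y : Sch) : (x + y).f = x.f + y.f := rfl
@[simp] theorem add_p (x y : Sch) : (x + y).p = x.p + y.p := rfl
@[simp] theorem add_q (x y : Sch) : (x + y).q = x.q + y.q := rfl
@[simp] theorem add_z (x y : Sch) : (x + y).z = x.z + y.z := rfl
@[simp] theorem neg_e (x : Sch) : (-x).e = -x.e := rfl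
@[simp] theorem neg_h (x : Sch) : (-x).h = -x.h := rfl
@[simp] theorem neg_f (x : Sch) : (-x).f = -x.f := rfl
@[simp] theorem neg_p (x : Sch) : (-x).p = -x.p := rfl
@[simp] theorem neg_q (x : Sch) : (-x).q = -x.q := rfl
@[simp] theorem neg_z (x : Sch) : (-x).z = -x.z := rfl
@[simp] theorem smul_e (c : ℂ) (x : Sch) : (c • x).e = c * x.e := rfl
@[simp] theorem smul_h (c : ℂ) (x : Sch) : (c • x).h = c * x.h := rfl
@[simp] theorem smul_f (c : ℂ) (x : Sch) : (c • x).f = c * x.f := rfl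
@[simp] theorem smul_p (c : ℂ) (x : Sch) : (c • x).p = c * x.p := rfl
@[simp] theorem smul_q (c : ℂ) (x : Sch) : (c • x).q = c * x.q := rfl
@[simp] theorem smul_z (c : ℂ) (x : Sch) : (c • x).z = c * x.z := rfl
@[simp] theorem lie_e (x y : Sch) : ⁅x, y⁆.e = 2 * (x.h * y.e - x.e * y.h) := rfl
@[simp] theorem lie_h (x y : Sch) : ⁅x, y⁆.h = x.e * y.f - x.f * y.e := rfl
@[simp] theorem lie_f (x y : Sch) : ⁅x, y⁆.f = -2 * (x.h * y.f - x.f * y.h) := rfl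
@[simp] theorem lie_p (x y : Sch) :
    ⁅x, y⁆.p = (x.h * y.p - x.p * y.h) + (x.e * y.q - x.q * y.e) := rfl
@[simp] theorem lie_q (x y : Sch) :
    ⁅x, y⁆.q = -(x.h * y.q - x.q * y.h) + (x.f * y.p - x.p * y.f) := rfl
@[simp] theorem lie_z (x y : Sch) : ⁅x, y⁆.z = x.p * y.q - x.q * y.p := rfl

instance : AddCommGroup Sch :=
  { AddGroup.ofLeftAxioms
      (fun x y z : Sch => by ext <;> simp <;> ring)
      (fun x : Sch => by ext <;> simp)
      (fun x : Sch => by ext <;> simp) with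
    add_comm := fun x y => by ext <;> simp <;> ring }

instance : Module ℂ Sch where
  one_smul x := by ext <;> simp
  mul_smul a b x := by ext <;> simp <;> ring
  smul_zero a := by ext <;> simp
  smul_add a x y := by ext <;> simp <;> ring
  add_smul a b x := by ext <;> simp <;> ring
  zero_smul x := by ext <;> simp

instance : LieRing Sch where
  add_lie x y w := by ext <;> simp <;> ring
  lie_add x y w := by ext <;> simp <;> ring
  lie_self x := by ext <;> simp <;> ring
  leibniz_lie x y w := by ext <;> simp <;> ring

instance : LieAlgebra ℂ Sch where
  lie_smul c x y := by ext <;> simp <;> ring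

instance : Module.Finite ℂ Sch := by
  let g : Sch →ₗ[ℂ] (Fin 6 → ℂ) :=
    { toFun := fun x => ![x.e, x.h, x.f, x.p, x.q, x.z]
      map_add' := fun x y => by ext i; fin_cases i <;> simp
      map_smul' := fun c x => by ext i; fin_cases i <;> simp }
  refine Module.Finite.of_injective g fun x y hxy => ?_
  ext
  · exact congrFun hxy 0
  · exact congrFun hxy 1
  · exact congrFun hxy 2
  · exact congrFun hxy 3
  · exact congrFun hxy 4
  · exact congrFun hxy 5

end Sch

/-- The universal enveloping algebra of the Schrödinger Lie algebra. -/
abbrev U : Type := UniversalEnvelopingAlgebra ℂ Sch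

noncomputable section

/-- The canonical map from the Schrödinger Lie algebra to its enveloping algebra. -/
abbrev toU : Sch →ₗ⁅ℂ⁆ U := UniversalEnvelopingAlgebra.ι ℂ

/-- The basis element `e`, in the enveloping algebra. -/
def eU : U := toU ⟨1, 0, 0, 0, 0, 0⟩

/-- The basis element `f`, in the enveloping algebra. -/
def fU : U := toU ⟨0, 0, 1, 0, 0, 0⟩

theorem subalgebra_eq_top (S : Subalgebra ℂ U) (hS : ∀ x : Sch, toU x ∈ S) : S = ⊤ := by
  let g : Sch →ₗ⁅ℂ⁆ S :=
    { toFun := fun x => ⟨toU x, hS x⟩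
      map_add' := fun x y => by ext; simp
      map_smul' := fun c x => by ext; simp
      map_lie' := fun {x y} => by
        ext
        simp [LieRing.of_associative_ring_bracket] }
  have hg : S.val.comp (UniversalEnvelopingAlgebra.lift ℂ g) = AlgHom.id ℂ U := by
    apply UniversalEnvelopingAlgebra.hom_ext
    ext x
    simp [g]
  refine Algebra.eq_top_iff.2 fun u => ?_
  have h := congrArg (fun F : U →ₐ[ℂ] U => F u) hg
  simp only [AlgHom.comp_apply, AlgHom.id_apply] at h
  rw [← h]
  exact (UniversalEnvelopingAlgebra.lift ℂ g u).2

/-! ## Tensor products over noncommutative rings -/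

section Balanced

variable (A R B M : Type*) [Ring A] [Algebra ℂ A] [Ring R]
  [AddCommGroup B] [Module ℂ B] [Module A B] [IsScalarTower ℂ A B] [Module Rᵐᵒᵖ B]
  [SMulCommClass A Rᵐᵒᵖ B] [SMulCommClass A ℂ B]
  [AddCommGroup M] [Module ℂ M] [Module R M]

/-- The `A`-submodule of `B ⊗[ℂ] M` generated by the elements `b r ⊗ m - b ⊗ r m`. -/
def balancedRel : Submodule A (B ⊗[ℂ] M) :=
  Submodule.span A {t | ∃ (b : B) (r : R) (m : M),
    t = (MulOpposite.op r • b) ⊗ₜ[ℂ] m - b ⊗ₜ[ℂ] (r • m)}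

/-- The left `A`-module `B ⊗_R M`, for an `A`-`R`-bimodule `B` and a left `R`-module `M`
(all of them complex vector spaces). -/
abbrev BalancedTensor : Type _ := (B ⊗[ℂ] M) ⧸ balancedRel A R B M

end Balanced

/-! ## Verma modules -/

/-- The Lie subalgebra spanned by `h, z, e, p`. -/
def borel : LieSubalgebra ℂ Sch where
  carrier := {x | x.f = 0 ∧ x.q = 0}
  zero_mem' := by simp
  add_mem' := fun {x y} hx hy => by simp_all
  smul_mem' := fun c x hx => by simp_all
  lie_mem' := fun {x y} hx hy => by simp_all

/-- The enveloping algebra of the subalgebra spanned by `h, z, e, p`. -/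
abbrev UB : Type := UniversalEnvelopingAlgebra ℂ borel

/-- The algebra map between enveloping algebras induced by the inclusion. -/
def UBtoU : UB →ₐ[ℂ] U := UniversalEnvelopingAlgebra.lift ℂ (toU.comp borel.incl)

/-- The enveloping algebra as a right module over that of the subalgebra. -/
instance : Module UBᵐᵒᵖ U := Module.compHom U UBtoU.toRingHom.op

instance : SMulCommClass U UBᵐᵒᵖ U where
  smul_comm u r v := (mul_assoc u v (UBtoU r.unop)).symm

/-- The character `h ↦ l₁`, `z ↦ l₂`, `e ↦ 0`, `p ↦ 0` of the subalgebra. -/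
def borelChar (l₁ l₂ : ℂ) : borel →ₗ⁅ℂ⁆ ℂ where
  toFun x := l₁ * x.1.h + l₂ * x.1.z
  map_add' x y := by simp; ring
  map_smul' c x := by simp; ring
  map_lie' := fun {x y} => by
    have hx := x.2
    have hy := y.2
    change x.1.f = 0 ∧ x.1.q = 0 at hx
    change y.1.f = 0 ∧ y.1.q = 0 at hy
    simp [LieRing.of_associative_ring_bracket, hx.1, hx.2, hy.1, hy.2, mul_comm]

/-- The one-dimensional module `ℂ_λ`, where `λ(h) = l₁` and `λ(z) = l₂`. -/
@[nolint unusedArguments]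
def CLam (_l₁ _l₂ : ℂ) : Type := ℂ

instance (l₁ l₂ : ℂ) : AddCommGroup (CLam l₁ l₂) := inferInstanceAs (AddCommGroup ℂ)
instance (l₁ l₂ : ℂ) : Module ℂ (CLam l₁ l₂) := inferInstanceAs (Module ℂ ℂ)
instance (l₁ l₂ : ℂ) : Module UB (CLam l₁ l₂) :=
  Module.compHom ℂ (UniversalEnvelopingAlgebra.lift ℂ (borelChar l₁ l₂)).toRingHom

/-- The Verma module `Δ(l₁, l₂)`, induced from `ℂ_λ`. -/
abbrev Verma (l₁ l₂ : ℂ) : Type := BalancedTensor U UB U (CLam l₁ l₂)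

/-! ## Localization of the enveloping algebra at the powers of `f` -/

section Ore

variable {A : Type*} [Ring A]

/-- The map `r ↦ x r - r x`. -/
def adMap (x : A) : A →+ A := AddMonoidHom.mulLeft x - AddMonoidHom.mulRight x

theorem adMap_apply (x r : A) : adMap x r = x * r - r * x := rfl

theorem adMap_iterate_mul (x : A) (N : ℕ) : ∀ (a b : ℕ) (r s : A), a + b = N →
    (adMap x)^[a] r = 0 → (adMap x)^[b] s = 0 → (adMap x)^[N] (r * s) = 0 := by
  induction N with
  | zero =>
    intro a b r s hab hr hs
    obtain ⟨rfl, rfl⟩ : a = 0 ∧ b = 0 := by omega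
    simp_all
  | succ N ih =>
    intro a b r s hab hr hs
    rcases a with _ | a
    · simp only [Function.iterate_zero, id] at hr
      simp [hr, iterate_map_zero]
    rcases b with _ | b
    · simp only [Function.iterate_zero, id] at hs
      simp [hs, iterate_map_zero]
    have h : adMap x (r * s) = adMap x r * s + r * adMap x s := by
      simp only [adMap_apply]; noncomm_ring
    rw [Function.iterate_succ_apply, h, iterate_map_add,
      ih a (b + 1) _ _ (by omega) (by rwa [← Function.iterate_succ_apply]) hs,
      ih (a + 1) b _ _ (by omega) hr (by rwa [← Function.iterate_succ_apply]), add_zero]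

theorem exists_pow_mul (x : A) (k : ℕ) : ∀ (r : A), (adMap x)^[k] r = 0 →
    ∀ n : ℕ, ∃ r' : A, x ^ (n + k) * r = r' * x ^ n := by
  induction k with
  | zero => intro r hr n; exact ⟨0, by simp_all⟩
  | succ k ihk =>
    intro r hr n
    induction n with
    | zero => exact ⟨x ^ (0 + (k + 1)) * r, by simp⟩
    | succ n ihn =>
      obtain ⟨r₁, h₁⟩ := ihn
      obtain ⟨r₂, h₂⟩ := ihk (adMap x r) (by rwa [← Function.iterate_succ_apply]) (n + 1)
      refine ⟨r₁ + r₂, ?_⟩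
      have hxr : x * r = r * x + adMap x r := by simp only [adMap_apply]; noncomm_ring
      have e₁ : n + 1 + (k + 1) = (n + (k + 1)) + 1 := by ring
      have e₂ : n + (k + 1) = n + 1 + k := by ring
      rw [e₁, pow_succ, mul_assoc, hxr, mul_add, ← mul_assoc, h₁, e₂, h₂, add_mul, mul_assoc,
        ← pow_succ]

theorem pow_mul_eq_zero (x : A) (k : ℕ) : ∀ (n : ℕ) (r : A), (adMap x)^[k] r = 0 →
    r * x ^ n = 0 → x ^ (n + k) * r = 0 := by
  induction k with
  | zero => intro n r hr _; simp_all
  | succ k ihk =>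
    intro n
    induction n with
    | zero => intro r _ h; simp_all
    | succ n ihn =>
      intro r hr h
      have hxr : x * r = r * x + adMap x r := by simp only [adMap_apply]; noncomm_ring
      have e₁ : n + 1 + (k + 1) = (n + (k + 1)) + 1 := by ring
      have e₂ : n + (k + 1) = n + 1 + k := by ring
      have hc : ∀ (j : ℕ) (s : A), (adMap x)^[j] (s * x) = (adMap x)^[j] s * x := by
        intro j
        induction j with
        | zero => intro s; rfl
        | succ j ih =>
          intro s
          have : adMap x (s * x) = adMap x s * x := by simp only [adMap_apply]; noncomm_ring
          rw [Function.iterate_succ_apply, this, ih, ← Function.iterate_succ_apply]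
      have h₁ : x ^ (n + (k + 1)) * (r * x) = 0 :=
        ihn (r * x) (by rw [hc, hr, zero_mul]) (by rw [mul_assoc, ← pow_succ', h])
      have h₂ : x ^ (n + 1 + k) * adMap x r = 0 := by
        refine ihk (n + 1) _ (by rwa [← Function.iterate_succ_apply]) ?_
        rw [adMap_apply, sub_mul, mul_assoc, h, mul_zero, zero_sub, mul_assoc, ← pow_succ',
          pow_succ, ← mul_assoc, h, zero_mul, neg_zero]
      rw [e₁, pow_succ, mul_assoc, hxr, mul_add, h₁, e₂, h₂, add_zero]

theorem nonempty_oreSet_powers (x : A) (hx : ∀ r : A, ∃ k : ℕ, (adMap x)^[k] r = 0) :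
    Nonempty (OreLocalization.OreSet (Submonoid.powers x)) := by
  rw [OreLocalization.nonempty_oreSet_iff]
  constructor
  · rintro r₁ r₂ ⟨_, n, rfl⟩ h
    obtain ⟨k, hk⟩ := hx (r₁ - r₂)
    refine ⟨⟨x ^ (n + k), n + k, rfl⟩, ?_⟩
    have h' := pow_mul_eq_zero x k n (r₁ - r₂) hk (by
      rw [sub_mul, sub_eq_zero]; exact h)
    rwa [mul_sub, sub_eq_zero] at h'
  · rintro r ⟨_, n, rfl⟩
    obtain ⟨k, hk⟩ := hx r
    obtain ⟨r', h⟩ := exists_pow_mul x k r hk n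
    exact ⟨r', ⟨x ^ (n + k), n + k, rfl⟩, h⟩

end Ore

theorem adMap_fU_toU (x : Sch) : adMap fU (toU x) = toU ⁅(⟨0, 0, 1, 0, 0, 0⟩ : Sch), x⁆ := by
  rw [LieHom.map_lie, LieRing.of_associative_ring_bracket]
  rfl

theorem adMap_fU_nilpotent (r : U) : ∃ k : ℕ, (adMap fU)^[k] r = 0 := by
  let S : Subalgebra ℂ U :=
    { carrier := {r | ∃ k : ℕ, (adMap fU)^[k] r = 0}
      mul_mem' := by
        rintro a b ⟨k, hk⟩ ⟨l, hl⟩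
        exact ⟨k + l, adMap_iterate_mul fU (k + l) k l a b rfl hk hl⟩
      add_mem' := by
        rintro a b ⟨k, hk⟩ ⟨l, hl⟩
        refine ⟨k + l, ?_⟩
        rw [iterate_map_add, Nat.add_comm k l, Function.iterate_add_apply, hk, iterate_map_zero,
          Nat.add_comm l k, Function.iterate_add_apply, hl, iterate_map_zero, add_zero]
      algebraMap_mem' := fun c => ⟨1, by
        rw [Function.iterate_one, adMap_apply, Algebra.commutes, sub_self]⟩ }
  have hS : S = ⊤ := subalgebra_eq_top S fun x => ⟨3, by
    have h0 : ⁅(⟨0, 0, 1, 0, 0, 0⟩ : Sch), ⁅(⟨0, 0, 1, 0, 0, 0⟩ : Sch),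
        ⁅(⟨0, 0, 1, 0, 0, 0⟩ : Sch), x⁆⁆⁆ = 0 := by ext <;> simp
    rw [Function.iterate_succ_apply, Function.iterate_succ_apply, Function.iterate_one,
      adMap_fU_toU, adMap_fU_toU, adMap_fU_toU, h0, map_zero]⟩
  have : r ∈ S := hS ▸ Algebra.mem_top
  exact this

/-- The powers of `f` satisfy the Ore conditions in the enveloping algebra. -/
instance oreSetF : OreLocalization.OreSet (Submonoid.powers fU) :=
  (nonempty_oreSet_powers fU adMap_fU_nilpotent).some

/-- The localization `U_(f)` of the enveloping algebra at the powers of `f`; its left `U`-module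
structure is multiplication on the left. -/
abbrev Uf : Type := OreLocalization (Submonoid.powers fU) U

/-- The canonical ring homomorphism `U → U_(f)`. -/
abbrev UtoUf : U →+* Uf := OreLocalization.numeratorRingHom

/-- The image of `U` in `U_(f)`, as a left `U`-submodule. -/
def imageU : Submodule U Uf := LinearMap.range (LinearMap.toSpanSingleton U Uf 1)

/-- The quotient `S_f = U_(f) / U`, a `U`-`U`-bimodule. Its left module structure is that of the
quotient of a left `U`-module by a submodule. -/
abbrev Sf : Type := Uf ⧸ imageU

theorem mem_imageU {x : Uf} : x ∈ imageU ↔ ∃ u : U, UtoUf u = x := by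
  have h : ∀ u : U, u • (1 : Uf) = UtoUf u := fun u => by
    rw [← OreLocalization.oreDiv_one_smul (S := Submonoid.powers fU), smul_eq_mul, mul_one]
    rfl
  simp [imageU, LinearMap.mem_range, LinearMap.toSpanSingleton_apply, h]

/-- Multiplication by `r ∈ U` on the right, as a left `U`-linear endomorphism of `S_f`. -/
def rightMul (r : U) : Sf →ₗ[U] Sf :=
  imageU.mapQ imageU
    { toFun := fun x => x * UtoUf r
      map_add' := fun x y => add_mul x y _
      map_smul' := fun u x => smul_mul_assoc u x _ }
    (fun x hx => by
      obtain ⟨u, rfl⟩ := mem_imageU.1 hx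
      exact mem_imageU.2 ⟨u * r, map_mul UtoUf u r⟩)

theorem rightMul_mk (r : U) (x : Uf) :
    rightMul r (Submodule.Quotient.mk x) = Submodule.Quotient.mk (x * UtoUf r) := rfl

/-- The right `U`-module structure of `S_f`, by multiplication on the right. -/
instance : Module Uᵐᵒᵖ Sf where
  smul r x := rightMul r.unop x
  one_smul x := by
    induction x using Submodule.Quotient.induction_on with | _ x =>
    change rightMul 1 _ = _
    rw [rightMul_mk, map_one, mul_one]
  mul_smul r s x := by
    induction x using Submodule.Quotient.induction_on with | _ x =>
    change rightMul (s.unop * r.unop) _ = rightMul r.unop (rightMul s.unop _)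
    rw [rightMul_mk, rightMul_mk, rightMul_mk, map_mul, mul_assoc]
  smul_zero r := map_zero (rightMul r.unop)
  smul_add r x y := map_add (rightMul r.unop) x y
  add_smul r s x := by
    induction x using Submodule.Quotient.induction_on with | _ x =>
    change rightMul (r.unop + s.unop) _ = rightMul r.unop _ + rightMul s.unop _
    rw [rightMul_mk, rightMul_mk, rightMul_mk, map_add, mul_add, Submodule.Quotient.mk_add]
  zero_smul x := by
    induction x using Submodule.Quotient.induction_on with | _ x =>
    change rightMul 0 _ = _
    rw [rightMul_mk, map_zero, mul_zero, Submodule.Quotient.mk_zero]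

instance : SMulCommClass U Uᵐᵒᵖ Sf where
  smul_comm u r x := ((rightMul r.unop).map_smul u x).symm

/-! ## The completion functor -/

section Completion

variable (M : Type*) [AddCommGroup M] [Module ℂ M] [Module U M] [IsScalarTower ℂ U M]

/-- The space `ℂ[e] m`. -/
def orbitSpan {M : Type*} [AddCommGroup M] [Module ℂ M] [Module U M] (m : M) : Submodule ℂ M :=
  Submodule.span ℂ (Set.range fun k : ℕ => eU ^ k • m)

variable {M} in
theorem finite_orbitSpan_iff (m : M) : FiniteDimensional ℂ (orbitSpan m) ↔
    ∃ N : Submodule ℂ M, FiniteDimensional ℂ N ∧ m ∈ N ∧ ∀ y ∈ N, eU • y ∈ N := by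
  constructor
  · intro h
    refine ⟨orbitSpan m, h, Submodule.subset_span ⟨0, by simp⟩, fun y hy => ?_⟩
    induction hy using Submodule.span_induction with
    | mem y hy =>
      obtain ⟨k, rfl⟩ := hy
      exact Submodule.subset_span ⟨k + 1, by simp only [pow_succ', mul_smul]⟩
    | zero => simp
    | add y z _ _ hy hz => rw [smul_add]; exact add_mem hy hz
    | smul c y _ hy =>
      rw [← algebraMap_smul U c y, ← mul_smul, ← Algebra.commutes, mul_smul, algebraMap_smul]
      exact Submodule.smul_mem _ c hy
  · rintro ⟨N, hN, hm, he⟩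
    have h : orbitSpan m ≤ N := by
      refine Submodule.span_le.2 ?_
      rintro _ ⟨k, rfl⟩
      induction k with
      | zero => simpa using hm
      | succ k ih =>
        simp only [pow_succ', mul_smul]
        exact he _ ih
    exact Submodule.finiteDimensional_of_le h

theorem finite_orbitSpan_toU_smul (x : Sch) (m : M) (hm : FiniteDimensional ℂ (orbitSpan m)) :
    FiniteDimensional ℂ (orbitSpan (toU x • m)) := by
  obtain ⟨N, hN, hmN, he⟩ := (finite_orbitSpan_iff m).1 hm
  rw [finite_orbitSpan_iff]
  let act : Sch →ₗ[ℂ] M →ₗ[ℂ] M :=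
    (Algebra.lsmul ℂ ℂ M).toLinearMap.comp (toU : Sch →ₗ[ℂ] U)
  have hact : ∀ (y : Sch) (n : M), act y n = toU y • n := fun _ _ => rfl
  let P : Submodule ℂ M := Submodule.map₂ act ⊤ N
  refine ⟨P, ?_, Submodule.apply_mem_map₂ act Submodule.mem_top hmN, fun w hw => ?_⟩
  · exact (Submodule.fg_iff_finiteDimensional _).1 <| Submodule.FG.map₂ _
      (Module.Finite.fg_top) ((Submodule.fg_iff_finiteDimensional _).2 hN)
  · have hP : P ≤ P.comap (Algebra.lsmul ℂ ℂ M eU) := by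
      refine Submodule.map₂_le.2 fun y _ n hn => ?_
      have h : eU * toU y = toU ⁅(⟨1, 0, 0, 0, 0, 0⟩ : Sch), y⁆ + toU y * eU := by
        rw [LieHom.map_lie, LieRing.of_associative_ring_bracket]
        exact (sub_add_cancel _ _).symm
      change eU • (toU y • n) ∈ P
      rw [← mul_smul, h, add_smul, mul_smul]
      exact add_mem (Submodule.apply_mem_map₂ act Submodule.mem_top hn)
        (Submodule.apply_mem_map₂ act Submodule.mem_top (he n hn))
    exact hP hw

theorem finite_orbitSpan_add (a b : M) (ha : FiniteDimensional ℂ (orbitSpan a))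
    (hb : FiniteDimensional ℂ (orbitSpan b)) : FiniteDimensional ℂ (orbitSpan (a + b)) := by
  obtain ⟨N, hN, haN, heN⟩ := (finite_orbitSpan_iff a).1 ha
  obtain ⟨P, hP, hbP, heP⟩ := (finite_orbitSpan_iff b).1 hb
  refine (finite_orbitSpan_iff _).2 ⟨N ⊔ P, inferInstance,
    Submodule.add_mem_sup haN hbP, fun y hy => ?_⟩
  obtain ⟨c, hc, d, hd, rfl⟩ := Submodule.mem_sup.1 hy
  rw [smul_add]
  exact Submodule.add_mem_sup (heN c hc) (heP d hd)

theorem finite_orbitSpan_smul (u : U) : ∀ m : M, FiniteDimensional ℂ (orbitSpan m) →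
    FiniteDimensional ℂ (orbitSpan (u • m)) := by
  let S : Subalgebra ℂ U :=
    { carrier := {u | ∀ m : M, FiniteDimensional ℂ (orbitSpan m) →
        FiniteDimensional ℂ (orbitSpan (u • m))}
      mul_mem' := by
        intro a b ha hb m hm
        rw [mul_smul]
        exact ha _ (hb m hm)
      add_mem' := by
        intro a b ha hb m hm
        rw [add_smul]
        exact finite_orbitSpan_add M _ _ (ha m hm) (hb m hm)
      algebraMap_mem' := by
        intro c m hm
        obtain ⟨N, hN, hmN, heN⟩ := (finite_orbitSpan_iff m).1 hm
        rw [algebraMap_smul]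
        exact (finite_orbitSpan_iff _).2 ⟨N, hN, N.smul_mem c hmN, heN⟩ }
  have hS : S = ⊤ := subalgebra_eq_top S fun x m hm => finite_orbitSpan_toU_smul M x m hm
  have : u ∈ S := hS ▸ Algebra.mem_top
  exact this

/-- The `U`-submodule of all `m ∈ M` on which `e` acts locally finitely, that is
`dim ℂ[e] m < ∞`. -/
def locallyFinite : Submodule U M where
  carrier := {m | FiniteDimensional ℂ (orbitSpan m)}
  add_mem' := fun {a b} ha hb => finite_orbitSpan_add M a b ha hb
  zero_mem' := (finite_orbitSpan_iff _).2 ⟨⊥, inferInstance, rfl, fun y hy => by simp_all⟩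
  smul_mem' := fun u m hm => finite_orbitSpan_smul M u m hm

/-- The completion `EnAr(M)`: the submodule of `S_f ⊗_U M` on which `e` acts locally finitely. -/
abbrev EnAr : Type _ := locallyFinite (BalancedTensor U U Sf M)

end Completion

/-- The module `V(n, l₂)`: the completion of `Δ(n - 1, l₂)` if `n ≥ 0`, and of `Δ(n - 2, l₂)` if
`n < 0`. -/
abbrev V (n : ℤ) (l₂ : ℂ) : Type := EnAr (Verma (if 0 ≤ n then n - 1 else n - 2) l₂)

/-- A left ideal of the enveloping algebra is centrally generated if it is generated by
its intersection with the center `Z`. -/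
def IsCentrallyGenerated (I : Ideal U) : Prop :=
  I = Ideal.span ((I : Set U) ∩ (Subalgebra.center ℂ U : Set U))

end

end Schroedinger

/-!
Write `C` for the cubic central element of `U`. On `Δ(l₁, l₂)`, and hence on its completion, `z`
acts as `l₂` and `C` acts as `l₂ c` with `c = l₁² + 3 l₁`. The substitution `l₁ ↦ -3 - l₁`, which
exchanges `n - 1` and `-n - 2`, leaves `c` unchanged. So the three annihilators all contain the
ideal `J` generated by `z - l₂` and `C - l₂ c`, and it is enough that `U / J` is simple and that the
three modules are nonzero.

In `U / J` the elements `p`, `q` form a Weyl pair up to the factor `l₂ ≠ 0`, and subtracting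
suitable quadratic expressions in `p` and `q` from `e`, `h`, `f` gives an `sl₂`-triple `E`, `H`, `F`
that commutes with `p` and `q` and whose Casimir element `H² + 2 H + 4 F E` is the scalar `c + 5/4`.
Commutators with the Weyl pair and with `H` reduce a two-sided ideal to its part in `ℂ[H]`. If the
ideal is proper and nonzero, this part has a finite, nonempty zero set, which contains the weights
of a finite-dimensional `sl₂`-module; but then the Casimir element is `(m + 1)² - 1` for some
natural number `m`, whereas `c + 9/4` is not the square of an integer.

The modules are seen to be nonzero in a space of formal sums of `f ^ i q ^ j v` over integers `i`,
`j`, on which `U` and `f ^ (-1)` act: it receives the Verma module, and its quotient by the sums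
supported on `i ≥ 0` receives the completion. The completion contains a vector
`∑ a_k f ^ (-k-1) ⊗ q ^ (2k+1) v` killed by `e`, whose image in this quotient is nonzero.
-/

namespace Schroedinger

open Polynomial

/-! ## Polynomials vanishing on root strings -/

section General

variable {k : Type*} [Field k]

theorem mem_of_sum_mem_of_eigenvectors {V ι : Type*} [AddCommGroup V] [Module k V]
    {T : Module.End k V} {W : Submodule k V} (hW : ∀ x ∈ W, T x ∈ W) {μ : ι → k}
    (hμ : Function.Injective μ) {x : ι → V} (hx : ∀ i, T (x i) = μ i • x i) {s : Finset ι}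
    (hs : ∑ i ∈ s, x i ∈ W) : ∀ i ∈ s, x i ∈ W := by
  let T' : Module.End k (V ⧸ W) := W.mapQ W T hW
  have hT' (i : ι) : W.mkQ (x i) ∈ T'.eigenspace (μ i) := by
    rw [Module.End.mem_eigenspace_iff, Submodule.mkQ_apply, Submodule.mapQ_apply, hx,
      Submodule.Quotient.mk_smul]
  have indep := (iSupIndep_iff_finsetSum_eq_zero_imp_eq_zero _).1 (T'.eigenspaces_iSupIndep.comp hμ)
    s (fun i => W.mkQ (x i)) (fun i _ => hT' i)
    (by rw [← map_sum, Submodule.mkQ_apply, Submodule.Quotient.mk_eq_zero]; exact hs)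
  exact fun i hi => (Submodule.Quotient.mk_eq_zero W).1 (indep i hi)

theorem exists_add_natCast_mul_mem_and_notMem [CharZero k] {Z : Set k} (hZ : Z.Finite) {x a : k}
    (hx : x ∈ Z) (ha : a ≠ 0) : ∃ j : ℕ, x + j * a ∈ Z ∧ x + (j + 1) * a ∉ Z := by
  by_contra! h
  have mem (j : ℕ) : x + j * a ∈ Z := by
    induction j with
    | zero => simpa using hx
    | succ j ih => exact_mod_cast h j ih
  refine (Set.infinite_range_of_injective fun i j hij => ?_).mono (Set.range_subset_iff.2 mem) hZ
  simpa [ha] using hij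

/-- The polynomial by which `f e` acts on an `h`-weight vector of a module over `sl₂` on which
the Casimir element `h² + 2 h + 4 f e` acts as `c`. -/
noncomputable def casimirPoly (c : k) : k[X] := C (1 / 4) * (C c - X ^ 2 - C 2 * X)

theorem eval_casimirPoly_eq_zero_iff [CharZero k] {c x : k} :
    (casimirPoly c).eval x = 0 ↔ (x + 1) ^ 2 = c + 1 := by
  have : (casimirPoly c).eval x = (c + 1 - (x + 1) ^ 2) / 4 := by
    simp only [casimirPoly, eval_sub, eval_C, eval_pow, eval_X, eval_mul]
    ring
  rw [this, div_eq_zero_iff, or_iff_left (OfNat.ofNat_ne_zero 4), sub_eq_zero, eq_comm]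

theorem casimirPoly_ne_zero [CharZero k] (c : k) : casimirPoly c ≠ 0 := by
  intro h
  have root (x : k) : (x + 1) ^ 2 = c + 1 := eval_casimirPoly_eq_zero_iff.1 (by simp [h])
  simpa using (root 0).trans (root (-1)).symm

/-- The common zeros of an ideal of polynomials in one variable. -/
def zeroLocus (J : Ideal k[X]) : Set k := {x | ∀ G ∈ J, G.eval x = 0}

theorem finite_zeroLocus {J : Ideal k[X]} (hJ : J ≠ ⊥) : (zeroLocus J).Finite := by
  obtain ⟨G, hG, hG0⟩ := Submodule.exists_mem_ne_zero_of_ne_bot hJ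
  refine (Polynomial.finite_setOfPred_isRoot hG0).subset fun x hx => hx G hG

theorem nonempty_zeroLocus [IsAlgClosed k] {J : Ideal k[X]} (hJ : J ≠ ⊤) :
    (zeroLocus J).Nonempty := by
  obtain ⟨G, rfl⟩ := IsPrincipalIdealRing.principal J
  have hG : G.degree ≠ 0 := fun h => hJ <| Ideal.span_singleton_eq_top.2 <|
    isUnit_iff_degree_eq_zero.2 h
  obtain ⟨x, hx⟩ := IsAlgClosed.exists_root G hG
  exact ⟨x, fun F hF => (hx.dvd (Ideal.mem_span_singleton.1 hF)).eq_zero⟩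

/-- The hypothesis on `c` says that no root string `x, x - 2, …, x - 2 m` carries a
representation of `sl₂` of dimension `m + 1` with Casimir `c`. -/
theorem eq_bot_or_eq_top_of_shift_mem [IsAlgClosed k] [CharZero k] {c : k}
    (hc : ∀ m : ℕ, ((m : k) + 1) ^ 2 ≠ c + 1) {J : Ideal k[X]}
    (hup : ∀ G ∈ J, taylor 2 G * casimirPoly c ∈ J)
    (hdown : ∀ G ∈ J, taylor (-2) (G * casimirPoly c) ∈ J) : J = ⊥ ∨ J = ⊤ := by
  by_contra! ⟨hbot, htop⟩
  have hfin := finite_zeroLocus hbot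
  have up {x : k} (hx : x ∈ zeroLocus J) (hx' : x + 2 ∉ zeroLocus J) :
      (x + 1) ^ 2 = c + 1 := by
    by_contra h
    refine hx' fun G hG => ?_
    simpa [eval_casimirPoly_eq_zero_iff, h, taylor_eval] using hx _ (hup G hG)
  have down {x : k} (hx : x ∈ zeroLocus J) (hx' : x + -2 ∉ zeroLocus J) :
      (x + -2 + 1) ^ 2 = c + 1 := by
    by_contra h
    refine hx' fun G hG => ?_
    simpa [eval_casimirPoly_eq_zero_iff, h, taylor_eval] using hx _ (hdown G hG)
  obtain ⟨y, hy⟩ := nonempty_zeroLocus htop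
  obtain ⟨i, hx, hx'⟩ :=
    exists_add_natCast_mul_mem_and_notMem hfin hy (two_ne_zero (α := k))
  obtain ⟨j, hz, hz'⟩ := exists_add_natCast_mul_mem_and_notMem hfin hx (a := -2) (by simp)
  rw [add_one_mul, ← add_assoc] at hx' hz'
  have htopRoot := up hx hx'
  have hbotRoot := down hz hz'
  have hxj : y + i * 2 = j := by
    have : ((j : k) + 1) * (y + i * 2 - j) = 0 := by
      linear_combination (htopRoot - hbotRoot) / 4
    simpa [Nat.cast_add_one_ne_zero, sub_eq_zero] using this
  exact hc j (hxj ▸ htopRoot)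

end General

/-! ## `sl₂`-triples with scalar Casimir element -/

section SlTwo

variable {k A : Type*} [Field k] [Ring A] [Algebra k A]

theorem aeval_mul_of_mul_eq_mul_add_smul {H Y : A} {a : k} (h : H * Y = Y * H + a • Y) (g : k[X]) :
    aeval H g * Y = Y * aeval H (taylor a g) := by
  induction g using Polynomial.induction_on' with
  | add g₁ g₂ h₁ h₂ => simp only [map_add, add_mul, mul_add, h₁, h₂]
  | monomial n b =>
    have hn : H ^ n * Y = Y * (H + algebraMap k A a) ^ n := by
      refine SemiconjBy.pow_right (a := Y) ?_ n |>.eq.symm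
      rw [SemiconjBy, mul_add, ← Algebra.commutes, ← Algebra.smul_def, h]
    rw [aeval_monomial, taylor_monomial, map_mul, map_pow, map_add, aeval_X, aeval_C, aeval_C,
      mul_assoc, hn, ← mul_assoc, Algebra.commutes, mul_assoc]

theorem mul_pow_eq_pow_mul_add_smul {H Y : A} {a : k} (h : H * Y = Y * H + a • Y) (n : ℕ) :
    H * Y ^ n = Y ^ n * H + (n * a) • Y ^ n := by
  induction n with
  | zero => simp
  | succ n ih =>
    rw [pow_succ, ← mul_assoc, ih, add_mul, mul_assoc, h, mul_add, smul_mul_assoc, mul_smul_comm,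
      ← mul_assoc, add_assoc, ← add_smul]
    push_cast
    ring_nf

theorem mul_pow_succ_mul_aeval {H X Y : A} {a : k} {P : k[X]} (hY : H * Y = Y * H + a • Y)
    (hXY : X * Y = aeval H P) (n : ℕ) (g : k[X]) :
    X * (Y ^ (n + 1) * aeval H g) = Y ^ n * aeval H (taylor (n * a) P * g) := by
  rw [pow_succ', mul_assoc, ← mul_assoc X, hXY, ← mul_assoc,
    aeval_mul_of_mul_eq_mul_add_smul (mul_pow_eq_pow_mul_add_smul hY n), mul_assoc, map_mul]

theorem eq_zero_of_pow_mul_aeval_mem {H X Y : A} {a : k} {P : k[X]} (hY : H * Y = Y * H + a • Y)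
    (hXY : X * Y = aeval H P) (hP : P ≠ 0) {I : Ideal A} (hI : I.comap (aeval (R := k) H) = ⊥)
    {n : ℕ} {g : k[X]} (hg : Y ^ n * aeval H g ∈ I) : g = 0 := by
  induction n generalizing g with
  | zero =>
    have : g ∈ I.comap (aeval (R := k) H) := by simpa using hg
    simpa [hI] using this
  | succ n ih =>
    have := ih (mul_pow_succ_mul_aeval hY hXY n g ▸ I.mul_mem_left X hg)
    simpa [hP, taylor_eq_zero] using this

/-- An `sl₂`-triple in an associative algebra whose Casimir element `H² + 2 H + 4 F E` is the
scalar `c`. -/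
structure IsSlTwoTriple (c : k) (E H F : A) : Prop where
  h_mul_e : H * E = E * H + (2 : k) • E
  h_mul_f : H * F = F * H + (-2 : k) • F
  e_mul_f : E * F = F * E + H
  casimir : H ^ 2 + (2 : k) • H + (4 : k) • (F * E) = algebraMap k A c

/-- The basis `E ^ i` for `i ≥ 0`, `F ^ (-i)` for `i < 0`, of the weight `2 i` part over `k[H]`. -/
def weightVector (E F : A) : ℤ → A
  | (n : ℕ) => E ^ n
  | Int.negSucc n => F ^ (n + 1)

/-- The sum over `i` of the spaces `weightVector E F i * k[H]`. -/
noncomputable def triangularSpan (k : Type*) {A : Type*} [Field k] [Ring A] [Algebra k A]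
    (E H F : A) : Submodule k A :=
  ⨆ i : ℤ, (aeval (R := k) H).toLinearMap.range.map (LinearMap.mulLeft k (weightVector E F i))

theorem weightVector_natCast (E F : A) (n : ℕ) : weightVector E F n = E ^ n := rfl

theorem weightVector_neg_natCast (E F : A) (n : ℕ) : weightVector E F (-n) = F ^ n := by
  cases n with
  | zero => exact (pow_zero E).trans (pow_zero F).symm
  | succ n => rfl

theorem weightVector_mul_aeval_mem (E H F : A) (i : ℤ) (g : k[X]) :
    weightVector E F i * aeval H g ∈ triangularSpan k E H F :=
  Submodule.mem_iSup_of_mem i ⟨_, ⟨g, rfl⟩, rfl⟩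

theorem triangularSpan_le {E H F : A} {S : Submodule k A}
    (h : ∀ (i : ℤ) (g : k[X]), weightVector E F i * aeval H g ∈ S) :
    triangularSpan k E H F ≤ S := by
  refine iSup_le fun i => ?_
  rintro _ ⟨_, ⟨g, rfl⟩, rfl⟩
  exact h i g

namespace IsSlTwoTriple

variable {c : k} {E H F : A}

theorem f_mul_e_eq_aeval [CharZero k] (t : IsSlTwoTriple c E H F) :
    F * E = aeval H (casimirPoly c) := by
  have : aeval H (casimirPoly c) = (1 / 4 : k) • (algebraMap k A c - H ^ 2 - (2 : k) • H) := by
    rw [casimirPoly, ← smul_eq_C_mul, ← smul_eq_C_mul]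
    simp only [map_smul, map_sub, map_pow, aeval_X, aeval_C]
  rw [this, ← t.casimir]
  module

theorem e_mul_f_eq_aeval [CharZero k] (t : IsSlTwoTriple c E H F) :
    E * F = aeval H (taylor (-2) (casimirPoly c)) := by
  have : taylor (-2) (casimirPoly c) = casimirPoly c + X := by
    have h2 : (C 2 : k[X]) = 2 := rfl
    have h4 : C (1 / 4 : k) * 4 = 1 := by
      rw [← C_ofNat, ← C_mul, one_div_mul_cancel (OfNat.ofNat_ne_zero 4), C_1]
    simp only [casimirPoly, taylor_mul, taylor_pow, map_sub, taylor_C, taylor_X, C_neg]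
    linear_combination X * h4 + 2 * C (1 / 4) * X * h2
  rw [this, map_add, aeval_X, ← t.f_mul_e_eq_aeval, t.e_mul_f]

theorem h_mul_weightVector (t : IsSlTwoTriple c E H F) (i : ℤ) :
    H * weightVector E F i = weightVector E F i * H + (2 * i : k) • weightVector E F i := by
  cases i with
  | ofNat n => simpa [weightVector, mul_comm] using mul_pow_eq_pow_mul_add_smul t.h_mul_e n
  | negSucc n =>
    have := mul_pow_eq_pow_mul_add_smul t.h_mul_f (n + 1)
    rw [show ((n + 1 : ℕ) : k) * -2 = 2 * (Int.negSucc n : ℤ) by push_cast; ring] at this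
    exact this

theorem e_mul_mem [CharZero k] (t : IsSlTwoTriple c E H F) :
    ∀ x ∈ triangularSpan k E H F, E * x ∈ triangularSpan k E H F := by
  refine triangularSpan_le (S := (triangularSpan k E H F).comap (LinearMap.mulLeft k E))
    fun i g => ?_
  rw [Submodule.mem_comap, LinearMap.mulLeft_apply]
  cases i with
  | ofNat n =>
    rw [Int.ofNat_eq_natCast, weightVector_natCast, ← mul_assoc, ← pow_succ']
    exact weightVector_mul_aeval_mem E H F (n + 1 : ℕ) g
  | negSucc n =>
    have := mul_pow_succ_mul_aeval t.h_mul_f t.e_mul_f_eq_aeval n g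
    rw [weightVector, this, ← weightVector_neg_natCast E F]
    exact weightVector_mul_aeval_mem E H F _ _

theorem f_mul_mem [CharZero k] (t : IsSlTwoTriple c E H F) :
    ∀ x ∈ triangularSpan k E H F, F * x ∈ triangularSpan k E H F := by
  refine triangularSpan_le (S := (triangularSpan k E H F).comap (LinearMap.mulLeft k F))
    fun i g => ?_
  rw [Submodule.mem_comap, LinearMap.mulLeft_apply]
  obtain ⟨n, rfl | rfl⟩ : ∃ n : ℕ, i = (n + 1 : ℕ) ∨ i = -n := by
    obtain ⟨n, rfl | rfl⟩ := i.eq_nat_or_neg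
    · cases n with
      | zero => exact ⟨0, .inr rfl⟩
      | succ n => exact ⟨n, .inl rfl⟩
    · exact ⟨n, .inr rfl⟩
  · have := mul_pow_succ_mul_aeval t.h_mul_e t.f_mul_e_eq_aeval n g
    rw [weightVector_natCast, this]
    exact weightVector_mul_aeval_mem E H F n _
  · rw [weightVector_neg_natCast, ← mul_assoc, ← pow_succ', ← weightVector_neg_natCast E F]
    exact weightVector_mul_aeval_mem E H F _ g

theorem comap_aeval_eq_bot [CharZero k] [IsAlgClosed k] (t : IsSlTwoTriple c E H F)
    (hc : ∀ m : ℕ, ((m : k) + 1) ^ 2 ≠ c + 1) {I : Ideal A} [I.IsTwoSided] (hI : I ≠ ⊤) :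
    I.comap (aeval (R := k) H) = ⊥ := by
  refine (eq_bot_or_eq_top_of_shift_mem hc (fun G hG => ?_) fun G hG => ?_).resolve_right
    (Ideal.comap_ne_top _ hI)
  · have := I.mul_mem_left F (I.mul_mem_right E hG)
    rwa [aeval_mul_of_mul_eq_mul_add_smul t.h_mul_e, ← mul_assoc, t.f_mul_e_eq_aeval, ← map_mul,
      mul_comm] at this
  · have := I.mul_mem_left E (I.mul_mem_right F hG)
    rwa [aeval_mul_of_mul_eq_mul_add_smul t.h_mul_f, ← mul_assoc, t.e_mul_f_eq_aeval, ← map_mul,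
      ← taylor_mul, mul_comm] at this

theorem disjoint_triangularSpan [CharZero k] [IsAlgClosed k] (t : IsSlTwoTriple c E H F)
    (hc : ∀ m : ℕ, ((m : k) + 1) ^ 2 ≠ c + 1) {I : Ideal A} [I.IsTwoSided] (hI : I ≠ ⊤) :
    Disjoint (I.restrictScalars k) (triangularSpan k E H F) := by
  have hbot := t.comap_aeval_eq_bot hc hI
  have homogeneous (i : ℤ) (g : k[X]) (h : weightVector E F i * aeval H g ∈ I) : g = 0 := by
    cases i with
    | ofNat n =>
      exact eq_zero_of_pow_mul_aeval_mem t.h_mul_e t.f_mul_e_eq_aeval (casimirPoly_ne_zero c) hbot h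
    | negSucc n =>
      exact eq_zero_of_pow_mul_aeval_mem t.h_mul_f t.e_mul_f_eq_aeval
        ((taylor_eq_zero _ _).not.2 (casimirPoly_ne_zero c)) hbot h
  refine Submodule.disjoint_def.2 fun x hxI hx => ?_
  obtain ⟨y, hy, rfl⟩ := (Submodule.mem_iSup_iff_exists_finsupp _ _).1 hx
  choose g hg using fun i => show ∃ g : k[X], weightVector E F i * aeval H g = y i by
    obtain ⟨_, ⟨g, rfl⟩, h⟩ := hy i
    exact ⟨g, h⟩
  have adH (i : ℤ) :
      (LinearMap.mulLeft k H - LinearMap.mulRight k H) (y i) = (2 * i : k) • y i := by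
    have comm : aeval H (g i) * H = H * aeval H (g i) := by
      simpa using congrArg (aeval H) (mul_comm (g i) X)
    rw [← hg, LinearMap.sub_apply, LinearMap.mulLeft_apply, LinearMap.mulRight_apply, ← mul_assoc,
      t.h_mul_weightVector, mul_assoc _ _ H, comm, add_mul, mul_assoc, add_sub_cancel_left,
      smul_mul_assoc]
  have mem := mem_of_sum_mem_of_eigenvectors (W := I.restrictScalars k)
    (fun x hx => sub_mem (I.mul_mem_left H hx) (I.mul_mem_right H hx))
    (fun i j hij => by simpa using hij) adH hxI
  refine Finset.sum_eq_zero fun i hi => ?_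
  rw [← hg i, homogeneous i (g i) (by rw [hg]; exact mem i hi), map_zero, mul_zero]

end IsSlTwoTriple

end SlTwo

/-! ## Simplicity from a commuting Weyl pair -/

section Weyl

variable {k A : Type*} [Field k] [Ring A] [Algebra k A]

theorem mul_pow_eq_pow_mul_add_smul_pow {T Y : A} {a : k}
    (h : T * Y = Y * T + algebraMap k A a) (n : ℕ) :
    T * Y ^ n = Y ^ n * T + (n * a) • Y ^ (n - 1) := by
  induction n with
  | zero => simp
  | succ n ih =>
    have hn : (n * a) • Y ^ (n - 1) * Y = (n * a) • Y ^ n := by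
      cases n with
      | zero => simp
      | succ n => rw [smul_mul_assoc, ← pow_succ, Nat.add_sub_cancel]
    rw [pow_succ, ← mul_assoc, ih, add_mul, mul_assoc, h, hn, mul_add, ← mul_assoc,
      ← Algebra.commutes, ← Algebra.smul_def, add_assoc, ← add_smul, Nat.add_sub_cancel]
    push_cast
    ring_nf

theorem commutator_pow_mul {T Y s : A} {a : k} (h : T * Y = Y * T + algebraMap k A a)
    (hs : Commute T s) (n : ℕ) :
    T * (Y ^ n * s) - Y ^ n * s * T = (n * a) • (Y ^ (n - 1) * s) := by
  rw [← mul_assoc, mul_pow_eq_pow_mul_add_smul_pow h, mul_assoc (Y ^ n) s, ← hs.eq, add_mul,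
    mul_assoc, add_sub_cancel_left, smul_mul_assoc]

/-- The sum over `j` of the spaces `Y ^ j * S`. -/
def powSpan (Y : A) (S : Submodule k A) : Submodule k A :=
  ⨆ j : ℕ, S.map (LinearMap.mulLeft k (Y ^ j))

variable {T Y x : A} {S : Submodule k A} {a : k}

theorem pow_mul_mem_powSpan (Y : A) {s : A} (hs : s ∈ S) (j : ℕ) : Y ^ j * s ∈ powSpan Y S :=
  Submodule.mem_iSup_of_mem j ⟨s, hs, rfl⟩

theorem powSpan_le {S' : Submodule k A} (h : ∀ j : ℕ, ∀ s ∈ S, Y ^ j * s ∈ S') :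
    powSpan Y S ≤ S' := by
  refine iSup_le fun j => ?_
  rintro _ ⟨s, hs, rfl⟩
  exact h j s hs

theorem le_powSpan (Y : A) (S : Submodule k A) : S ≤ powSpan Y S := fun s hs => by
  simpa using pow_mul_mem_powSpan Y hs 0

theorem self_mul_mem_powSpan (Y : A) (S : Submodule k A) : ∀ y ∈ powSpan Y S, Y * y ∈ powSpan Y S :=
  powSpan_le (S' := (powSpan Y S).comap (LinearMap.mulLeft k Y)) fun j s hs => by
    rw [Submodule.mem_comap, LinearMap.mulLeft_apply, ← mul_assoc, ← pow_succ']
    exact pow_mul_mem_powSpan Y hs (j + 1)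

theorem mul_mem_powSpan (h : T * Y = Y * T + algebraMap k A a) (hS : ∀ s ∈ S, T * s ∈ S) :
    ∀ y ∈ powSpan Y S, T * y ∈ powSpan Y S :=
  powSpan_le (S' := (powSpan Y S).comap (LinearMap.mulLeft k T)) fun j s hs => by
    rw [Submodule.mem_comap, LinearMap.mulLeft_apply, ← mul_assoc,
      mul_pow_eq_pow_mul_add_smul_pow h, add_mul, mul_assoc, smul_mul_assoc]
    exact add_mem (pow_mul_mem_powSpan Y (hS s hs) j)
      (Submodule.smul_mem _ _ (pow_mul_mem_powSpan Y hs _))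

variable (k) in
theorem mem_centralizer_singleton_iff {y : A} :
    y ∈ Subalgebra.centralizer k {x} ↔ Commute x y := by
  simp only [Subalgebra.mem_centralizer_iff, Set.mem_singleton_iff, forall_eq, Commute, SemiconjBy]

theorem commute_of_mem_powSpan (hY : Commute x Y) (hS : ∀ s ∈ S, Commute x s) :
    ∀ y ∈ powSpan Y S, Commute x y :=
  fun _ hy => (mem_centralizer_singleton_iff k).1 <|
    powSpan_le (S' := (Subalgebra.centralizer k {x}).toSubmodule)
      (fun j s hs => (mem_centralizer_singleton_iff k).2 ((hY.pow_right j).mul_right (hS s hs))) hy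

/-- The Euler operator `x ↦ Y * (T * x - x * T)` separates the summands `Y ^ j * S`, and
bracketing with `T` lowers the power of `Y`. -/
theorem disjoint_powSpan [CharZero k] (ha : a ≠ 0) (h : T * Y = Y * T + algebraMap k A a)
    (hS : ∀ s ∈ S, Commute T s) {I : Ideal A} [I.IsTwoSided]
    (hI : Disjoint (I.restrictScalars k) S) :
    Disjoint (I.restrictScalars k) (powSpan Y S) := by
  have ad_mem {x : A} (hx : x ∈ I) : T * x - x * T ∈ I :=
    sub_mem (I.mul_mem_left T hx) (I.mul_mem_right T hx)
  have homogeneous (j : ℕ) {s : A} (hs : s ∈ S) (hj : Y ^ j * s ∈ I) : s = 0 := by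
    induction j with
    | zero => exact Submodule.disjoint_def.1 hI s (by simpa using hj) hs
    | succ j ih =>
      have := ad_mem hj
      rw [commutator_pow_mul h (hS s hs)] at this
      exact ih (((I.restrictScalars k).smul_mem_iff
        (mul_ne_zero (Nat.cast_ne_zero.2 j.succ_ne_zero) ha)).1 this)
  refine Submodule.disjoint_def.2 fun x hxI hx => ?_
  obtain ⟨y, hy, rfl⟩ := (Submodule.mem_iSup_iff_exists_finsupp _ _).1 hx
  choose s hs hsy using hy
  have euler (j : ℕ) : (LinearMap.mulLeft k Y ∘ₗ (LinearMap.mulLeft k T - LinearMap.mulRight k T))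
      (y j) = (j * a) • y j := by
    rw [← hsy, LinearMap.comp_apply, LinearMap.sub_apply]
    simp only [LinearMap.mulLeft_apply, LinearMap.mulRight_apply]
    rw [commutator_pow_mul h (hS _ (hs j)), mul_smul_comm, ← mul_assoc]
    cases j with
    | zero => simp
    | succ j => rw [Nat.add_sub_cancel, ← pow_succ']
  have mem := mem_of_sum_mem_of_eigenvectors (W := I.restrictScalars k)
    (fun x hx => I.mul_mem_left Y (ad_mem hx)) (fun i j hij => by simpa [ha] using hij) euler hxI
  refine Finset.sum_eq_zero fun j hj => ?_
  have : Y ^ j * s j ∈ I := by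
    have := mem j hj
    rwa [← hsy] at this
  rw [← hsy, homogeneous j (hs j) this, map_zero]

theorem eq_top_of_one_mem_of_mul_mem {X : Set A} (hX : Algebra.adjoin k X = ⊤)
    (h1 : 1 ∈ S) (hS : ∀ x ∈ X, ∀ s ∈ S, x * s ∈ S) : S = ⊤ := by
  refine Submodule.eq_top_iff'.2 fun y => ?_
  suffices ∀ s ∈ S, y * s ∈ S by simpa using this 1 h1
  refine Algebra.adjoin_induction (s := X) (p := fun y _ => ∀ s ∈ S, y * s ∈ S) hS
    (fun c s hs => ?_) (fun y z _ _ hy hz s hs => ?_) (fun y z _ _ hy hz s hs => ?_)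
    (hX ▸ Algebra.mem_top)
  · rw [← Algebra.smul_def]
    exact S.smul_mem c hs
  · rw [add_mul]
    exact add_mem (hy s hs) (hz s hs)
  · rw [mul_assoc]
    exact hy _ (hz s hs)

theorem IsSlTwoTriple.commute_of_mem_triangularSpan {c : k} {E H F : A}
    (t : IsSlTwoTriple c E H F) (hE : Commute x E) (hF : Commute x F) :
    ∀ y ∈ triangularSpan k E H F, Commute x y := by
  have hH : Commute x H := by
    rw [← sub_eq_iff_eq_add'.2 t.e_mul_f]
    exact (hE.mul_right hF).sub_right (hF.mul_right hE)
  have h_aeval (g : k[X]) : Commute x (aeval H g) :=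
    (mem_centralizer_singleton_iff k).1 <| Algebra.adjoin_le
      (Set.singleton_subset_iff.2 ((mem_centralizer_singleton_iff k).2 hH))
      (aeval_mem_adjoin_singleton k H)
  have h_weight (i : ℤ) : Commute x (weightVector E F i) := by
    cases i with
    | ofNat n => exact hE.pow_right n
    | negSucc n => exact hF.pow_right (n + 1)
  exact fun _ hy => (mem_centralizer_singleton_iff k).1 <|
    triangularSpan_le (S := (Subalgebra.centralizer k {x}).toSubmodule)
      (fun i g => (mem_centralizer_singleton_iff k).2 ((h_weight i).mul_right (h_aeval g))) hy

/-- The subspaces `k[Q] k[P] (∑ E ^ i k[H] + ∑ F ^ i k[H])` exhaust the algebra, and disjointness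
from a proper ideal propagates from the triangular part. -/
theorem isSimpleRing_of_isSlTwoTriple [CharZero k] [IsAlgClosed k] [Nontrivial A]
    {c l : k} {E H F P Q : A} (t : IsSlTwoTriple c E H F)
    (hc : ∀ m : ℕ, ((m : k) + 1) ^ 2 ≠ c + 1) (hl : l ≠ 0)
    (hPQ : P * Q = Q * P + algebraMap k A l)
    (hcomm : ∀ x ∈ ({P, Q} : Set A), ∀ y ∈ ({E, F} : Set A), Commute x y)
    (hgen : Algebra.adjoin k {E, F, P, Q} = ⊤) : IsSimpleRing A := by
  have hQP : Q * P = P * Q + algebraMap k A (-l) := by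
    rw [hPQ, map_neg, add_neg_cancel_right]
  simp only [Set.mem_insert_iff, Set.mem_singleton_iff, forall_eq_or_imp, forall_eq] at hcomm
  obtain ⟨⟨hPE, hPF⟩, hQE, hQF⟩ := hcomm
  have hP := t.commute_of_mem_triangularSpan hPE hPF
  have hQ := t.commute_of_mem_triangularSpan hQE hQF
  let S := powSpan P (triangularSpan k E H F)
  have htop : powSpan Q S = ⊤ := by
    refine eq_top_of_one_mem_of_mul_mem hgen ?_ ?_
    · refine le_powSpan _ _ (le_powSpan _ _ ?_)
      have := weightVector_mul_aeval_mem E H F (0 : ℕ) (1 : k[X])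
      rwa [weightVector_natCast, pow_zero, map_one, mul_one] at this
    · have lift {x : A} (hPx : Commute P x) (hQx : Commute Q x)
          (hx : ∀ s ∈ triangularSpan k E H F, x * s ∈ triangularSpan k E H F) :
          ∀ y ∈ powSpan Q S, x * y ∈ powSpan Q S :=
        mul_mem_powSpan (a := 0) (by simpa using hQx.eq.symm)
          (mul_mem_powSpan (a := 0) (by simpa using hPx.eq.symm) hx)
      simp only [Set.mem_insert_iff, Set.mem_singleton_iff, forall_eq_or_imp, forall_eq]
      exact ⟨lift hPE hQE t.e_mul_mem, lift hPF hQF t.f_mul_mem,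
        mul_mem_powSpan hPQ (self_mul_mem_powSpan P _), self_mul_mem_powSpan Q S⟩
  refine .of_eq_bot_or_eq_top fun I => or_iff_not_imp_right.2 fun hI => ?_
  have hI' : I.asIdeal ≠ ⊤ := fun h => hI (I.one_mem_iff.1 ((Ideal.eq_top_iff_one _).1 h))
  have hdisj := disjoint_powSpan hl hPQ (commute_of_mem_powSpan (Commute.refl P) hP) <|
    disjoint_powSpan (neg_ne_zero.2 hl) hQP hQ (t.disjoint_triangularSpan hc hI')
  rw [htop, disjoint_top] at hdisj
  exact eq_bot_iff.2 fun x hx => (Submodule.eq_bot_iff _).1 hdisj x hx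

end Weyl

/-! ## The enveloping algebra modulo a central character -/

section Relations

theorem mul_mul_of_mul_eq {A : Type*} [Semigroup A] {a b c : A} (h : a * b = c) (x : A) :
    a * (b * x) = c * x := by
  rw [← mul_assoc, h]

/-- The defining relations of the enveloping algebra of the Schrödinger algebra, oriented as rewrite
rules that bring the generators into the order `z, f, q, h, p, e`. -/
structure SchRelations {A : Type*} [Ring A] (e h f p q z : A) : Prop where
  h_f : h * f = f * h - 2 • f
  e_f : e * f = f * e + h
  p_f : p * f = f * p - q
  q_f : q * f = f * q
  h_q : h * q = q * h - q
  p_q : p * q = q * p + z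
  e_q : e * q = q * e + p
  p_h : p * h = h * p - p
  e_h : e * h = h * e - 2 • e
  e_p : e * p = p * e
  f_z : f * z = z * f
  q_z : q * z = z * q
  h_z : h * z = z * h
  p_z : p * z = z * p
  e_z : e * z = z * e

/-- The cubic central element `z (h² + 3 h + 4 f e) + 2 h q p + 4 q p - 2 f p² + 2 q² e` of the
enveloping algebra of the Schrödinger algebra. -/
def cubicCasimir {A : Type*} [Ring A] (e h f p q z : A) : A :=
  z * (h * h + 3 • h + 4 • (f * e)) + 2 • (h * (q * p)) + 4 • (q * p) - 2 • (f * (p * p)) +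
    2 • (q * (q * e))

namespace SchRelations

variable {A : Type*} [Ring A] {e h f p q z : A}

theorem map {B F : Type*} [Ring B] [FunLike F A B] [RingHomClass F A B]
    (D : SchRelations e h f p q z) (φ : F) :
    SchRelations (φ e) (φ h) (φ f) (φ p) (φ q) (φ z) where
  h_f := by simpa only [map_mul, map_sub, map_nsmul] using congrArg φ D.h_f
  e_f := by simpa only [map_mul, map_add] using congrArg φ D.e_f
  p_f := by simpa only [map_mul, map_sub] using congrArg φ D.p_f
  q_f := by simpa only [map_mul] using congrArg φ D.q_f
  h_q := by simpa only [map_mul, map_sub] using congrArg φ D.h_q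
  p_q := by simpa only [map_mul, map_add] using congrArg φ D.p_q
  e_q := by simpa only [map_mul, map_add] using congrArg φ D.e_q
  p_h := by simpa only [map_mul, map_sub] using congrArg φ D.p_h
  e_h := by simpa only [map_mul, map_sub, map_nsmul] using congrArg φ D.e_h
  e_p := by simpa only [map_mul] using congrArg φ D.e_p
  f_z := by simpa only [map_mul] using congrArg φ D.f_z
  q_z := by simpa only [map_mul] using congrArg φ D.q_z
  h_z := by simpa only [map_mul] using congrArg φ D.h_z
  p_z := by simpa only [map_mul] using congrArg φ D.p_z
  e_z := by simpa only [map_mul] using congrArg φ D.e_z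

theorem commute_cubicCasimir (D : SchRelations e h f p q z) :
    ∀ x ∈ ({e, f, p} : Set A), Commute x (cubicCasimir e h f p q z) := by
  rintro x (rfl | rfl | rfl) <;>
  · simp only [commute_iff_eq, cubicCasimir, mul_add, add_mul, mul_sub, sub_mul, smul_add, smul_sub,
      mul_smul_comm, smul_mul_assoc, mul_assoc, D.h_f, D.e_f, D.p_f, D.h_q, D.p_q, D.p_h,
      D.e_h, D.e_p, D.f_z, mul_mul_of_mul_eq D.h_f, mul_mul_of_mul_eq D.e_f,
      mul_mul_of_mul_eq D.p_f, mul_mul_of_mul_eq D.q_f, mul_mul_of_mul_eq D.h_q,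
      mul_mul_of_mul_eq D.p_q, mul_mul_of_mul_eq D.e_q, mul_mul_of_mul_eq D.p_h,
      mul_mul_of_mul_eq D.e_h, mul_mul_of_mul_eq D.e_p, mul_mul_of_mul_eq D.f_z,
      mul_mul_of_mul_eq D.q_z, mul_mul_of_mul_eq D.p_z,
      mul_mul_of_mul_eq D.e_z]
    abel

variable {k : Type*} [Field k] [CharZero k] [Algebra k A] {l c : k}

/-- The correction terms by the Weyl pair `p, q` make the triple commute with `p` and `q`. -/
theorem isSlTwoTriple (D : SchRelations e h f p q z) (hl : l ≠ 0) (hz : z = l • 1)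
    (hC : cubicCasimir e h f p q z = (l * c) • 1) :
    IsSlTwoTriple (c + 5 / 4) (e - (1 / (2 * l)) • (p * p))
      (h + (1 / l) • (q * p) + (1 / 2 : k) • 1) (f + (1 / (2 * l)) • (q * q)) := by
  have hpq : p * q = q * p + l • 1 := by rw [D.p_q, hz]
  constructor
  case casimir =>
    have hc : (1 / l) • cubicCasimir e h f p q z = c • 1 := by
      rw [hC, smul_smul]; congr 1; field_simp
    rw [Algebra.algebraMap_eq_smul_one, add_smul, ← hc, cubicCasimir, hz]
    simp only [sq, mul_add, add_mul, mul_sub, smul_add, smul_sub, mul_smul_comm, mul_one, one_mul,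
      smul_mul_assoc, mul_assoc, D.p_h, mul_mul_of_mul_eq D.h_q, mul_mul_of_mul_eq hpq, sub_mul]
    match_scalars <;> field_simp <;> ring
  all_goals
    simp only [mul_add, add_mul, mul_sub, sub_mul, smul_add, smul_sub, mul_smul_comm, mul_one,
      one_mul, smul_mul_assoc, mul_assoc, D.h_f, D.e_f, D.p_f, D.h_q, hpq, D.e_q, D.p_h,
      D.e_h, D.e_p, mul_mul_of_mul_eq D.p_f, mul_mul_of_mul_eq D.q_f, mul_mul_of_mul_eq D.h_q,
      mul_mul_of_mul_eq hpq, mul_mul_of_mul_eq D.e_q, mul_mul_of_mul_eq D.p_h]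
    match_scalars <;> field_simp <;> ring

theorem isSimpleRing [IsAlgClosed k] [Nontrivial A] (D : SchRelations e h f p q z) (hl : l ≠ 0)
    (hz : z = l • 1) (hC : cubicCasimir e h f p q z = (l * c) • 1)
    (hc : ∀ m : ℕ, ((m : k) + 1) ^ 2 ≠ c + 9 / 4) (hgen : Algebra.adjoin k {e, f, p} = ⊤) :
    IsSimpleRing A := by
  have hpq : p * q = q * p + l • 1 := by rw [D.p_q, hz]
  refine isSimpleRing_of_isSlTwoTriple (P := p) (Q := q) (l := l) (D.isSlTwoTriple hl hz hC)
    (fun m => ?_) hl ?_ ?_ ?_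
  · convert hc m using 1
    ring
  · rw [hpq, Algebra.algebraMap_eq_smul_one]
  · rintro x (rfl | rfl) y (rfl | rfl) <;>
      simp only [commute_iff_eq, mul_add, add_mul, mul_sub, sub_mul, mul_smul_comm, mul_one,
        one_mul, smul_mul_assoc, mul_assoc, D.p_f, D.q_f, hpq, D.e_q, D.e_p,
        mul_mul_of_mul_eq hpq, smul_add]
    all_goals
      match_scalars <;> field_simp
      ring
  · refine eq_top_iff.2 (hgen ▸ Algebra.adjoin_le ?_)
    set S := Algebra.adjoin k {e - (1 / (2 * l)) • (p * p), f + (1 / (2 * l)) • (q * q), p, q}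
    have hE : e - (1 / (2 * l)) • (p * p) ∈ S := Algebra.subset_adjoin (by simp)
    have hF : f + (1 / (2 * l)) • (q * q) ∈ S := Algebra.subset_adjoin (by simp)
    have hP : p ∈ S := Algebra.subset_adjoin (by simp)
    have hQ : q ∈ S := Algebra.subset_adjoin (by simp)
    rintro x (rfl | rfl | rfl)
    · simpa using add_mem hE (S.smul_mem (mul_mem hP hP) (1 / (2 * l)))
    · simpa using sub_mem hF (S.smul_mem (mul_mem hQ hQ) (1 / (2 * l)))
    · exact hP

end SchRelations

end Relations

section CentralIdeal

attribute [local instance] LieRing.ofAssociativeRing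

/-- The basis element `h`, in the enveloping algebra. -/
noncomputable def hU : U := toU ⟨0, 1, 0, 0, 0, 0⟩

/-- The basis element `p`, in the enveloping algebra. -/
noncomputable def pU : U := toU ⟨0, 0, 0, 1, 0, 0⟩

/-- The basis element `q`, in the enveloping algebra. -/
noncomputable def qU : U := toU ⟨0, 0, 0, 0, 1, 0⟩

/-- The basis element `z`, in the enveloping algebra. -/
noncomputable def zU : U := toU ⟨0, 0, 0, 0, 0, 1⟩

theorem toU_eq (x : Sch) :
    toU x = x.e • eU + x.h • hU + x.f • fU + x.p • pU + x.q • qU + x.z • zU := by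
  simp only [eU, hU, fU, pU, qU, zU, ← map_smul, ← map_add]
  congr 1
  ext <;> simp

theorem schRelations_U : SchRelations eU hU fU pU qU zU := by
  constructor <;>
  · refine (sub_eq_iff_eq_add'.1 (toU.map_lie _ _).symm).trans ?_
    rw [toU_eq ⁅_, _⁆]
    simp only [eU, hU, fU, pU, qU, zU, Sch.lie_e, Sch.lie_h, Sch.lie_f, Sch.lie_p, Sch.lie_q,
      Sch.lie_z]
    module

theorem adjoin_e_f_p_eq_top : Algebra.adjoin ℂ {eU, fU, pU} = ⊤ := by
  set S := Algebra.adjoin ℂ {eU, fU, pU}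
  have he : eU ∈ S := Algebra.subset_adjoin (by simp)
  have hf : fU ∈ S := Algebra.subset_adjoin (by simp)
  have hp : pU ∈ S := Algebra.subset_adjoin (by simp)
  have hh : hU ∈ S := by
    rw [← sub_eq_iff_eq_add'.2 schRelations_U.e_f]
    exact sub_mem (mul_mem he hf) (mul_mem hf he)
  have hq : qU ∈ S := by
    rw [← sub_eq_iff_eq_add'.2 (eq_sub_iff_add_eq.1 schRelations_U.p_f).symm]
    exact sub_mem (mul_mem hf hp) (mul_mem hp hf)
  have hz : zU ∈ S := by
    rw [← sub_eq_iff_eq_add'.2 schRelations_U.p_q]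
    exact sub_mem (mul_mem hp hq) (mul_mem hq hp)
  refine subalgebra_eq_top S fun x => ?_
  rw [toU_eq]
  refine add_mem (add_mem (add_mem (add_mem (add_mem ?_ ?_) ?_) ?_) ?_) ?_ <;>
  exact S.smul_mem (by assumption) _

theorem mem_center_of_commute {c : U} (hc : ∀ x ∈ ({eU, fU, pU} : Set U), Commute x c) :
    c ∈ Subalgebra.center ℂ U := by
  have h : Algebra.adjoin ℂ {eU, fU, pU} ≤ Subalgebra.centralizer ℂ {c} :=
    Algebra.adjoin_le fun x hx => (mem_centralizer_singleton_iff ℂ).2 (hc x hx).symm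
  rw [adjoin_e_f_p_eq_top] at h
  exact Subalgebra.mem_center_iff.2 fun b =>
    ((mem_centralizer_singleton_iff ℂ).1 (h (Algebra.mem_top (x := b)))).symm

/-- The cubic central element of the enveloping algebra of the Schrödinger algebra. -/
noncomputable def casU : U := cubicCasimir eU hU fU pU qU zU

theorem casU_mem_center : casU ∈ Subalgebra.center ℂ U :=
  mem_center_of_commute schRelations_U.commute_cubicCasimir

theorem zU_mem_center : zU ∈ Subalgebra.center ℂ U := by
  refine mem_center_of_commute ?_
  rintro x (rfl | rfl | rfl)
  exacts [schRelations_U.e_z, schRelations_U.f_z, schRelations_U.p_z]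

/-- The central elements `z - l` and `C - l c`, for the cubic central element `C`. -/
def centralGenerators (l c : ℂ) : Set U := {zU - l • 1, casU - (l * c) • 1}

theorem centralGenerators_subset_center (l c : ℂ) :
    centralGenerators l c ⊆ (Subalgebra.center ℂ U : Set U) := by
  rintro x (rfl | rfl)
  · exact sub_mem zU_mem_center (Subalgebra.smul_mem _ (one_mem _) _)
  · exact sub_mem casU_mem_center (Subalgebra.smul_mem _ (one_mem _) _)

/-- The ideal of the enveloping algebra cut out by the central character `z ↦ l`, `C ↦ l c`. -/
def centralIdeal (l c : ℂ) : Ideal U := Ideal.span (centralGenerators l c)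

theorem isTwoSided_span_of_subset_center {A : Type*} [Ring A] {s : Set A}
    (hs : s ⊆ Set.center A) : (Ideal.span s).IsTwoSided := by
  refine ⟨fun {a} b ha => ?_⟩
  induction ha using Submodule.span_induction with
  | mem x hx =>
    rw [(hs hx).comm b]
    exact Ideal.mul_mem_left _ _ (Ideal.subset_span hx)
  | zero => rw [zero_mul]; exact zero_mem _
  | add x y _ _ hx hy => rw [add_mul]; exact add_mem hx hy
  | smul r x _ hx => rw [smul_eq_mul, mul_assoc]; exact Ideal.mul_mem_left _ _ hx

instance (l c : ℂ) : (centralIdeal l c).IsTwoSided :=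
  isTwoSided_span_of_subset_center (centralGenerators_subset_center l c)

theorem isCentrallyGenerated_centralIdeal (l c : ℂ) : IsCentrallyGenerated (centralIdeal l c) :=
  le_antisymm
    (Ideal.span_mono <| Set.subset_inter Ideal.subset_span (centralGenerators_subset_center l c))
    (Ideal.span_le.2 Set.inter_subset_left)

theorem isSimpleRing_quotient_centralIdeal {l c : ℂ} (hl : l ≠ 0)
    (hc : ∀ m : ℕ, ((m : ℂ) + 1) ^ 2 ≠ c + 9 / 4) (htop : centralIdeal l c ≠ ⊤) :
    IsSimpleRing (U ⧸ centralIdeal l c) := by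
  let π := Ideal.Quotient.mkₐ ℂ (centralIdeal l c)
  have hπ {u v : U} (h : u - v ∈ centralIdeal l c) : π u = π v := Ideal.Quotient.eq.2 h
  have : Nontrivial (U ⧸ centralIdeal l c) := Ideal.Quotient.nontrivial_iff.2 htop
  refine (schRelations_U.map π).isSimpleRing (l := l) (c := c) hl ?_ ?_ hc ?_
  · simpa using hπ (Ideal.subset_span (Or.inl rfl) : zU - l • 1 ∈ centralIdeal l c)
  · simpa [casU, cubicCasimir, -nsmul_eq_mul] using
      hπ (Ideal.subset_span (Or.inr rfl) : casU - (l * c) • 1 ∈ centralIdeal l c)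
  · have h := AlgHom.map_adjoin π {eU, fU, pU}
    rw [adjoin_e_f_p_eq_top, Algebra.map_top,
      (AlgHom.range_eq_top π).2 Ideal.Quotient.mk_surjective] at h
    simpa only [Set.image_insert_eq, Set.image_singleton] using h.symm

theorem annihilator_eq_centralIdeal {l c : ℂ} (hl : l ≠ 0)
    (hc : ∀ m : ℕ, ((m : ℂ) + 1) ^ 2 ≠ c + 9 / 4) {N : Type*} [AddCommGroup N] [Module U N]
    [Nontrivial N] (hN : centralIdeal l c ≤ Module.annihilator U N) :
    Module.annihilator U N = centralIdeal l c := by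
  have htop : centralIdeal l c ≠ ⊤ := fun h => by
    have := Module.annihilator_eq_top_iff.1 (top_le_iff.1 (h ▸ hN))
    exact not_subsingleton N this
  have := isSimpleRing_quotient_centralIdeal hl hc htop
  obtain ⟨x, hx⟩ := exists_ne (0 : N)
  have : Nontrivial (AddMonoid.End N) := ⟨1, 0, fun h => hx (DFunLike.congr_fun h x)⟩
  refine le_antisymm (fun u hu => ?_) hN
  let ρ : U ⧸ centralIdeal l c →+* AddMonoid.End N :=
    Ideal.Quotient.lift _ (Module.toAddMonoidEnd U N) fun a ha =>
      AddMonoidHom.ext (Module.mem_annihilator.1 (hN ha))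
  have hρ : ρ (Ideal.Quotient.mk _ u) = 0 := AddMonoidHom.ext (Module.mem_annihilator.1 hu)
  exact Ideal.Quotient.eq_zero_iff_mem.1 (ρ.injective (hρ.trans (map_zero ρ).symm))

end CentralIdeal

section BalancedTensor

variable {A R B M : Type*} [Ring A] [Algebra ℂ A] [Ring R] [AddCommGroup B] [Module ℂ B]
  [Module A B] [IsScalarTower ℂ A B] [Module Rᵐᵒᵖ B] [AddCommGroup M] [Module ℂ M] [Module R M]

variable (A R) in
/-- The class of the pure tensor `b ⊗ m` in `B ⊗_R M`. -/
def btmul (b : B) (m : M) : BalancedTensor A R B M := Submodule.Quotient.mk (b ⊗ₜ[ℂ] m)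

theorem btmul_add (b b' : B) (m : M) :
    btmul A R (b + b') m = btmul A R b m + btmul A R b' m := by
  simp only [btmul, TensorProduct.add_tmul, Submodule.Quotient.mk_add]

theorem smul_btmul' (c : ℂ) (b : B) (m : M) :
    btmul A R (c • b) m = c • btmul A R b m := by
  simp only [btmul, ← TensorProduct.smul_tmul', Submodule.Quotient.mk_smul]

theorem btmul_smul (b : B) (c : ℂ) (m : M) :
    btmul A R b (c • m) = c • btmul A R b m := by
  simp only [btmul, TensorProduct.tmul_smul, Submodule.Quotient.mk_smul]

theorem btmul_zero (b : B) : btmul A R b (0 : M) = 0 := by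
  simpa only [zero_smul] using btmul_smul (A := A) (R := R) b 0 (0 : M)

theorem smul_btmul (a : A) (b : B) (m : M) : a • btmul A R b m = btmul A R (a • b) m := rfl

theorem op_smul_btmul (b : B) (r : R) (m : M) :
    btmul A R (MulOpposite.op r • b) m = btmul A R b (r • m) :=
  (Submodule.Quotient.eq _).2 (Submodule.subset_span ⟨b, r, m, rfl⟩)

theorem balancedTensor_induction {motive : BalancedTensor A R B M → Prop}
    (zero : motive 0) (btmul : ∀ b m, motive (btmul A R b m))
    (add : ∀ x y, motive x → motive y → motive (x + y)) (x : BalancedTensor A R B M) :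
    motive x := by
  induction x using Submodule.Quotient.induction_on with | _ x =>
  induction x using TensorProduct.induction_on with
  | zero => exact zero
  | tmul b m => exact btmul b m
  | add x y hx hy => exact add _ _ hx hy

theorem mem_annihilator_balancedTensor {a : A} {r : R}
    (har : ∀ b : B, a • b = MulOpposite.op r • b) (hr : r ∈ Module.annihilator R M) :
    a ∈ Module.annihilator A (BalancedTensor A R B M) := by
  refine Module.mem_annihilator.2 fun x => ?_
  induction x using balancedTensor_induction with
  | zero => exact smul_zero a
  | btmul b m => rw [smul_btmul, har, op_smul_btmul, Module.mem_annihilator.1 hr, btmul_zero]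
  | add x y hx hy => rw [smul_add, hx, hy, add_zero]

variable {P : Type*} [AddCommGroup P] [Module ℂ P] [Module A P] [IsScalarTower ℂ A P]

/-- The map `B ⊗_R M → P`, `b ⊗ m ↦ g b m`, given by an `R`-balanced map `g`. -/
def balancedLift (g : B →ₗ[A] M →ₗ[ℂ] P)
    (hg : ∀ b (r : R) m, g (MulOpposite.op r • b) m = g b (r • m)) :
    BalancedTensor A R B M →ₗ[A] P :=
  (balancedRel A R B M).liftQ (TensorProduct.AlgebraTensorModule.lift g) <| by
    refine Submodule.span_le.2 ?_
    rintro _ ⟨b, r, m, rfl⟩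
    simp only [SetLike.mem_coe, LinearMap.mem_ker, map_sub,
      TensorProduct.AlgebraTensorModule.lift_tmul, hg, sub_self]

theorem balancedLift_btmul (g : B →ₗ[A] M →ₗ[ℂ] P)
    (hg : ∀ b (r : R) m, g (MulOpposite.op r • b) m = g b (r • m)) (b : B) (m : M) :
    balancedLift g hg (btmul A R b m) = g b m := rfl

end BalancedTensor

/-! ## Highest weight vectors -/

section HighestWeight

attribute [local instance] LieRing.ofAssociativeRing

theorem adjoin_range_ι_eq_top (k L : Type*) [CommRing k] [LieRing L] [LieAlgebra k L] :
    Algebra.adjoin k (Set.range (UniversalEnvelopingAlgebra.ι k : L → _)) = ⊤ := by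
  set S := Algebra.adjoin k (Set.range (UniversalEnvelopingAlgebra.ι k : L → _))
  let g : L →ₗ⁅k⁆ S :=
    { toFun := fun x => ⟨UniversalEnvelopingAlgebra.ι k x, Algebra.subset_adjoin ⟨x, rfl⟩⟩
      map_add' := fun x y => Subtype.ext (map_add _ x y)
      map_smul' := fun c x => Subtype.ext (map_smul _ c x)
      map_lie' := fun {x y} => Subtype.ext (LieHom.map_lie _ x y) }
  have hg : S.val.comp (UniversalEnvelopingAlgebra.lift k g) = AlgHom.id k _ := by
    apply UniversalEnvelopingAlgebra.hom_ext
    ext x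
    exact congrArg S.val (UniversalEnvelopingAlgebra.lift_ι_apply k g x)
  refine Algebra.eq_top_iff.2 fun u => ?_
  have hu : (UniversalEnvelopingAlgebra.lift k g u : _) = u := DFunLike.congr_fun hg u
  exact hu ▸ (UniversalEnvelopingAlgebra.lift k g u).2

theorem eU_smul_qU_smul {P : Type*} [AddCommGroup P] [Module U P] (x : P) :
    eU • qU • x = qU • eU • x + pU • x := by
  rw [← mul_smul, schRelations_U.e_q, add_smul, mul_smul]

theorem pU_smul_qU_smul {P : Type*} [AddCommGroup P] [Module U P] (x : P) :
    pU • qU • x = qU • pU • x + zU • x := by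
  rw [← mul_smul, schRelations_U.p_q, add_smul, mul_smul]

variable {l₁ l₂ : ℂ} {P : Type*} [AddCommGroup P] [Module ℂ P] [Module U P]

/-- The vector `w` is killed by `e` and `p`, and `h`, `z` act on it as `l₁`, `l₂`. It may vanish. -/
def IsHighestWeight (l₁ l₂ : ℂ) (w : P) : Prop :=
  ∀ x : borel, toU x.1 • w = borelChar l₁ l₂ x • w

namespace IsHighestWeight

variable {w : P} (hw : IsHighestWeight l₁ l₂ w)
include hw

theorem e_smul : eU • w = 0 := by
  have h := hw ⟨⟨1, 0, 0, 0, 0, 0⟩, rfl, rfl⟩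
  simpa [eU, borelChar] using h

theorem p_smul : pU • w = 0 := by
  have h := hw ⟨⟨0, 0, 0, 1, 0, 0⟩, rfl, rfl⟩
  simpa [pU, borelChar] using h

theorem h_smul : hU • w = l₁ • w := by
  have h := hw ⟨⟨0, 1, 0, 0, 0, 0⟩, rfl, rfl⟩
  simpa [hU, borelChar] using h

theorem z_smul : zU • w = l₂ • w := by
  have h := hw ⟨⟨0, 0, 0, 0, 0, 1⟩, rfl, rfl⟩
  simpa [zU, borelChar] using h

theorem e_smul_q : eU • qU • w = 0 := by
  rw [eU_smul_qU_smul, hw.e_smul, hw.p_smul, smul_zero, add_zero]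

variable [IsScalarTower ℂ U P]

theorem UBtoU_smul (r : UB) :
    UBtoU r • w = UniversalEnvelopingAlgebra.lift ℂ (borelChar l₁ l₂) r • w := by
  have hr : r ∈ Algebra.adjoin ℂ (Set.range (UniversalEnvelopingAlgebra.ι ℂ : borel → UB)) :=
    adjoin_range_ι_eq_top ℂ borel ▸ Algebra.mem_top
  induction hr using Algebra.adjoin_induction with
  | mem r hr =>
    obtain ⟨x, rfl⟩ := hr
    rw [UBtoU, UniversalEnvelopingAlgebra.lift_ι_apply, UniversalEnvelopingAlgebra.lift_ι_apply]
    exact hw x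
  | algebraMap c => simp only [AlgHom.commutes, algebraMap_smul, Algebra.algebraMap_self_apply]
  | add r s _ _ hr hs => simp only [map_add, add_smul, hr, hs]
  | mul r s _ _ hr hs => rw [map_mul, map_mul, mul_smul, hs, smul_comm, hr, smul_smul, mul_comm]

theorem casU_smul : casU • w = (l₂ * (l₁ ^ 2 + 3 * l₁)) • w := by
  simp only [casU, cubicCasimir, add_smul, sub_smul, mul_smul, smul_add, smul_assoc, hw.e_smul,
    hw.p_smul, hw.h_smul, smul_zero, smul_comm (M := U) (N := ℂ), hw.z_smul,
    ← Nat.cast_smul_eq_nsmul ℂ]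
  module

theorem h_smul_q_pow (j : ℕ) : hU • qU ^ j • w = (l₁ - j) • qU ^ j • w := by
  induction j with
  | zero => simpa using hw.h_smul
  | succ j ih =>
    rw [pow_succ', mul_smul, ← mul_smul hU, schRelations_U.h_q, sub_smul, mul_smul, ih,
      smul_comm qU]
    generalize qU • qU ^ j • w = x
    push_cast
    module

theorem z_smul_smul (u : U) : zU • u • w = l₂ • u • w := by
  rw [← mul_smul, ← Subalgebra.mem_center_iff.1 zU_mem_center, mul_smul, hw.z_smul, smul_comm]

theorem p_smul_q_pow_succ (j : ℕ) :
    pU • qU ^ (j + 1) • w = ((j + 1) * l₂) • qU ^ j • w := by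
  induction j with
  | zero => simp [pU_smul_qU_smul, hw.p_smul, hw.z_smul]
  | succ j ih =>
    rw [pow_succ', mul_smul, pU_smul_qU_smul, ih, hw.z_smul_smul, smul_comm qU, ← mul_smul qU,
      ← pow_succ']
    generalize qU ^ (j + 1) • w = x
    push_cast
    module

theorem e_smul_q_pow_add_two (j : ℕ) :
    eU • qU ^ (j + 2) • w = ((j + 2) * (j + 1) / 2 * l₂) • qU ^ j • w := by
  induction j with
  | zero =>
    rw [zero_add, pow_two, mul_smul, eU_smul_qU_smul, hw.e_smul_q, ← pow_one qU,
      hw.p_smul_q_pow_succ 0]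
    simp
  | succ j ih =>
    rw [pow_succ', mul_smul, eU_smul_qU_smul, ih, smul_comm qU, ← mul_smul qU, ← pow_succ',
      hw.p_smul_q_pow_succ]
    generalize qU ^ (j + 1) • w = x
    push_cast
    module

end IsHighestWeight

end HighestWeight

section Verma

variable {l₁ l₂ : ℂ}

/-- The coordinate on the line `ℂ_λ`. -/
noncomputable def cLamEquiv (l₁ l₂ : ℂ) : CLam l₁ l₂ ≃ₗ[ℂ] ℂ := LinearEquiv.refl ℂ ℂ

theorem cLamEquiv_smul (r : UB) (c : CLam l₁ l₂) : cLamEquiv l₁ l₂ (r • c) =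
    UniversalEnvelopingAlgebra.lift ℂ (borelChar l₁ l₂) r * cLamEquiv l₁ l₂ c := rfl

theorem op_smul_U (r : UB) (u : U) : MulOpposite.op r • u = u * UBtoU r := rfl

/-- The highest weight vector `1 ⊗ 1` of the Verma module. -/
noncomputable def hwVec (l₁ l₂ : ℂ) : Verma l₁ l₂ := btmul U UB 1 ((cLamEquiv l₁ l₂).symm 1)

theorem btmul_eq_smul_hwVec (u : U) (c : CLam l₁ l₂) :
    btmul U UB u c = (cLamEquiv l₁ l₂ c • u) • hwVec l₁ l₂ := by
  obtain ⟨a, rfl⟩ := (cLamEquiv l₁ l₂).symm.surjective c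
  rw [hwVec, smul_btmul, smul_eq_mul, mul_one, LinearEquiv.apply_symm_apply, smul_btmul',
    ← btmul_smul, ← map_smul, smul_eq_mul, mul_one]

theorem isHighestWeight_hwVec (l₁ l₂ : ℂ) : IsHighestWeight l₁ l₂ (hwVec l₁ l₂) := fun x => by
  have hx : toU x.1 • (1 : U) = MulOpposite.op (UniversalEnvelopingAlgebra.ι ℂ x : UB) • 1 := by
    rw [op_smul_U, UBtoU, UniversalEnvelopingAlgebra.lift_ι_apply, one_mul, smul_eq_mul, mul_one]
    rfl
  rw [hwVec, smul_btmul, hx, op_smul_btmul, btmul_eq_smul_hwVec, cLamEquiv_smul,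
    UniversalEnvelopingAlgebra.lift_ι_apply, LinearEquiv.apply_symm_apply, mul_one, smul_assoc,
    one_smul, hwVec]

theorem exists_smul_hwVec (x : Verma l₁ l₂) : ∃ u : U, u • hwVec l₁ l₂ = x := by
  induction x using balancedTensor_induction with
  | zero => exact ⟨0, zero_smul _ _⟩
  | btmul u c => exact ⟨_, (btmul_eq_smul_hwVec u c).symm⟩
  | add x y hx hy =>
    obtain ⟨u, rfl⟩ := hx
    obtain ⟨v, rfl⟩ := hy
    exact ⟨u + v, add_smul _ _ _⟩

theorem mem_annihilator_verma {c : U} (hc : c ∈ Subalgebra.center ℂ U)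
    (h : c • hwVec l₁ l₂ = 0) : c ∈ Module.annihilator U (Verma l₁ l₂) := by
  refine Module.mem_annihilator.2 fun x => ?_
  obtain ⟨u, rfl⟩ := exists_smul_hwVec x
  rw [← mul_smul, ← Subalgebra.mem_center_iff.1 hc u, mul_smul, h, smul_zero]

theorem centralGenerators_subset_annihilator_verma (l₁ l₂ : ℂ) :
    centralGenerators l₂ (l₁ ^ 2 + 3 * l₁) ⊆ Module.annihilator U (Verma l₁ l₂) := by
  have hw := isHighestWeight_hwVec l₁ l₂
  refine fun x hx => mem_annihilator_verma (centralGenerators_subset_center _ _ hx) ?_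
  obtain rfl | rfl := hx
  · rw [sub_smul, smul_assoc, one_smul, hw.z_smul, sub_self]
  · rw [sub_smul, smul_assoc, one_smul, hw.casU_smul, sub_self]

section Lift

variable {P : Type*} [AddCommGroup P] [Module ℂ P] [Module U P] [IsScalarTower ℂ U P]

/-- The homomorphism from the Verma module that sends its highest weight vector to `w`. -/
noncomputable def vermaLift {w : P} (hw : IsHighestWeight l₁ l₂ w) : Verma l₁ l₂ →ₗ[U] P :=
  balancedLift
    (LinearMap.toSpanSingleton U _ ((cLamEquiv l₁ l₂).toLinearMap.smulRight w)) fun u r c => by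
      simp only [LinearMap.toSpanSingleton_apply, LinearMap.smul_apply, LinearMap.smulRight_apply,
        LinearEquiv.coe_coe, op_smul_U, cLamEquiv_smul, mul_smul]
      rw [smul_comm (UBtoU r), hw.UBtoU_smul, smul_comm (cLamEquiv l₁ l₂ c) (_ : ℂ)]

theorem vermaLift_hwVec {w : P} (hw : IsHighestWeight l₁ l₂ w) :
    vermaLift hw (hwVec l₁ l₂) = w := by
  simp [vermaLift, hwVec, balancedLift_btmul]

end Lift

end Verma

/-! ## The fractions `f ^ (-i) ⊗ m` -/

section Localization

theorem smul_Uf (u : U) (x : Uf) : u • x = UtoUf u * x :=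
  (OreLocalization.oreDiv_one_smul u x).symm

theorem UtoUf_mul_comm {c : U} (hc : c ∈ Subalgebra.center ℂ U) (x : Uf) :
    UtoUf c * x = x * UtoUf c := by
  induction x using OreLocalization.ind with | _ r s =>
  have hs : UtoUf (s : U) * (r /ₒ s) = UtoUf r := OreLocalization.mul_cancel
  have hu : IsUnit (UtoUf (s : U)) := OreLocalization.numerator_isUnit s
  refine hu.mul_left_cancel ?_
  rw [← mul_assoc, ← mul_assoc, hs, ← map_mul, Subalgebra.mem_center_iff.1 hc, map_mul, mul_assoc,
    hs, ← map_mul, ← map_mul, Subalgebra.mem_center_iff.1 hc]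

theorem smul_Sf_eq_op_smul {c : U} (hc : c ∈ Subalgebra.center ℂ U) (x : Sf) :
    c • x = MulOpposite.op c • x := by
  induction x using Submodule.Quotient.induction_on with | _ x =>
  change Submodule.Quotient.mk (c • x) = Submodule.Quotient.mk (x * UtoUf c)
  rw [smul_Uf, UtoUf_mul_comm hc]

theorem mem_annihilator_enAr {M : Type*} [AddCommGroup M] [Module ℂ M] [Module U M]
    [IsScalarTower ℂ U M] {c : U} (hc : c ∈ Subalgebra.center ℂ U)
    (h : c ∈ Module.annihilator U M) : c ∈ Module.annihilator U (EnAr M) :=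
  LinearMap.annihilator_le_of_injective (Submodule.subtype _) (Submodule.subtype_injective _) <|
    mem_annihilator_balancedTensor (smul_Sf_eq_op_smul hc) h

section Inverse

variable {A : Type*} [Ring A] {e h : A} {f : Aˣ}

theorem mul_inv_of_mul_eq_sub (h_f : h * f = f * h - 2 • (f : A)) :
    h * ↑f⁻¹ = ↑f⁻¹ * h + 2 • (↑f⁻¹ : A) := by
  have := congrArg (fun x => (↑f⁻¹ : A) * x * ↑f⁻¹) h_f
  simp only [mul_sub, sub_mul, mul_assoc, Units.mul_inv, Units.inv_mul_cancel_left, mul_one,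
    smul_mul_assoc, mul_smul_comm] at this
  rw [this, sub_add_cancel]

theorem mul_inv_pow_of_mul_eq_sub (h_f : h * f = f * h - 2 • (f : A)) (e_f : e * f = f * e + h)
    (i : ℕ) : e * ↑f⁻¹ ^ i =
      ↑f⁻¹ ^ i * e - (i • (↑f⁻¹ ^ (i + 1) * h) + (i * (i + 1)) • (↑f⁻¹ ^ (i + 1) : A)) := by
  have e_inv : e * ↑f⁻¹ = ↑f⁻¹ * e - (↑f⁻¹ ^ 2 * h + 2 • (↑f⁻¹ ^ 2 : A)) := by
    have := congrArg (fun x => (↑f⁻¹ : A) * x * ↑f⁻¹) e_f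
    simp only [mul_add, add_mul, mul_assoc, Units.mul_inv, Units.inv_mul_cancel_left, mul_one,
      mul_inv_of_mul_eq_sub h_f, mul_smul_comm] at this
    rw [this, pow_two, mul_assoc, add_sub_cancel_right]
  induction i with
  | zero => simp
  | succ i ih =>
    rw [pow_succ (↑f⁻¹ : A) i, ← mul_assoc, ih, sub_mul, mul_assoc (↑f⁻¹ ^ i : A), e_inv, add_mul,
      smul_mul_assoc, smul_mul_assoc, mul_assoc _ h, mul_inv_of_mul_eq_sub h_f]
    simp only [mul_sub, mul_add, mul_smul_comm, ← mul_assoc, ← pow_succ, ← pow_add]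
    module

end Inverse

/-- The element `f`, as a unit of `U_(f)`. -/
noncomputable def fUnit : Ufˣ :=
  OreLocalization.numeratorUnit (⟨fU, Submonoid.mem_powers fU⟩ : Submonoid.powers fU)

theorem eU_smul_fUnit_inv_pow_add (i : ℕ) :
    eU • (↑fUnit⁻¹ ^ i : Uf) + ((i : ℂ) • (↑fUnit⁻¹ ^ (i + 1) * UtoUf hU) +
      (i * (i + 1) : ℂ) • (↑fUnit⁻¹ ^ (i + 1) : Uf)) = ↑fUnit⁻¹ ^ i * UtoUf eU := by
  have hR := schRelations_U.map UtoUf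
  have h := mul_inv_pow_of_mul_eq_sub (f := fUnit) hR.h_f hR.e_f i
  rw [smul_Uf, ← eq_sub_iff_add_eq, h]
  norm_cast

variable {M : Type*} [AddCommGroup M] [Module ℂ M] [Module U M]

/-- The class of `f ^ (-i) ⊗ m` in `S_f ⊗_U M`. -/
noncomputable def fracTensor (i : ℕ) (m : M) : BalancedTensor U U Sf M :=
  btmul U U (Submodule.Quotient.mk (↑fUnit⁻¹ ^ i)) m

theorem fracTensor_smul (i : ℕ) (c : ℂ) (m : M) : fracTensor i (c • m) = c • fracTensor i m :=
  btmul_smul _ _ _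

theorem fracTensor_zero (i : ℕ) : fracTensor i (0 : M) = 0 := btmul_zero _

theorem btmul_mk_mul (i : ℕ) (u : U) (m : M) :
    btmul U U (Submodule.Quotient.mk (↑fUnit⁻¹ ^ i * UtoUf u) : Sf) m = fracTensor i (u • m) :=
  op_smul_btmul (Submodule.Quotient.mk (↑fUnit⁻¹ ^ i) : Sf) u m

theorem eU_smul_fracTensor (i : ℕ) (m : M) : eU • fracTensor i m = fracTensor i (eU • m) -
    ((i : ℂ) • fracTensor (i + 1) (hU • m) + (i * (i + 1) : ℂ) • fracTensor (i + 1) m) := by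
  have h := congrArg (fun x => btmul U U (Submodule.Quotient.mk x : Sf) m)
    (eU_smul_fUnit_inv_pow_add i)
  simp only [Submodule.Quotient.mk_add, Submodule.Quotient.mk_smul, btmul_add, smul_btmul',
    btmul_mk_mul] at h
  exact eq_sub_of_add_eq h

end Localization

/-! ## Formal sums of the vectors `f ^ i q ^ j v` -/

section FormalModel

attribute [local instance] LieRing.ofAssociativeRing

theorem smul_mem_of_toU_smul_mem {P : Type*} [AddCommGroup P] [Module ℂ P] [Module U P]
    [IsScalarTower ℂ U P] {N : Submodule ℂ P} (hN : ∀ (x : Sch), ∀ y ∈ N, toU x • y ∈ N) (u : U)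
    {y : P} (hy : y ∈ N) : u • y ∈ N := by
  have hu : u ∈ Algebra.adjoin ℂ (Set.range toU) := adjoin_range_ι_eq_top ℂ Sch ▸ Algebra.mem_top
  induction hu using Algebra.adjoin_induction generalizing y with
  | mem u hu => obtain ⟨x, rfl⟩ := hu; exact hN x y hy
  | algebraMap c => rw [algebraMap_smul]; exact N.smul_mem c hy
  | add u v _ _ hu hv => rw [add_smul]; exact N.add_mem (hu hy) (hv hy)
  | mul u v _ _ hu hv => rw [mul_smul]; exact hu (hv hy)

-- The coefficient formulas come from the commutation relations in `U_(f)`, for instance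
-- `e f^i q^j v = (j (j - 1) / 2) l₂ f^i q^(j - 2) v + i (l₁ - j - i + 1) f^(i - 1) q^j v`.
/-- The action of the Schrödinger algebra on functions `φ : ℤ → ℤ → ℂ`, where `φ i j` stands for the
coefficient of the formal vector `f ^ i q ^ j v`, with `v` a highest weight vector. -/
noncomputable def coeffAction (l₁ l₂ : ℂ) : Sch →ₗ⁅ℂ⁆ Module.End ℂ (ℤ → ℤ → ℂ) where
  toFun x :=
    { toFun := fun φ i j =>
        x.e * (l₂ * (j + 2) * (j + 1) / 2 * φ i (j + 2) + (i + 1) * (l₁ - j - i) * φ (i + 1) j) +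
        x.h * ((l₁ - 2 * i - j) * φ i j) +
        x.f * φ (i - 1) j +
        x.p * ((j + 1) * l₂ * φ i (j + 1) - (i + 1) * φ (i + 1) (j - 1)) +
        x.q * φ i (j - 1) +
        x.z * (l₂ * φ i j)
      map_add' := fun φ ψ => by ext i j; simp only [Pi.add_apply]; ring
      map_smul' := fun c φ => by
        ext i j; simp only [Pi.smul_apply, smul_eq_mul, RingHom.id_apply]; ring }
  map_add' x y := by
    refine LinearMap.ext fun φ => funext₂ fun i j => ?_
    simp only [Sch.add_e, Sch.add_h, Sch.add_f, Sch.add_p, Sch.add_q, Sch.add_z, LinearMap.coe_mk,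
      AddHom.coe_mk, LinearMap.add_apply, Pi.add_apply]
    ring
  map_smul' c x := by
    refine LinearMap.ext fun φ => funext₂ fun i j => ?_
    simp only [Sch.smul_e, Sch.smul_h, Sch.smul_f, Sch.smul_p, Sch.smul_q, Sch.smul_z,
      LinearMap.coe_mk, AddHom.coe_mk, LinearMap.smul_apply, Pi.smul_apply, smul_eq_mul,
      RingHom.id_apply]
    ring
  map_lie' {x y} := by
    refine LinearMap.ext fun φ => funext₂ fun i j => ?_
    simp only [LieRing.of_associative_ring_bracket, Module.End.mul_apply, LinearMap.sub_apply,
      Pi.sub_apply, LinearMap.coe_mk, AddHom.coe_mk, Sch.lie_e, Sch.lie_h, Sch.lie_f, Sch.lie_p,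
      Sch.lie_q, Sch.lie_z]
    push_cast
    ring_nf

/-- A completion of the localized Verma module `U_(f) ⊗_U Δ(l₁, l₂)`, in coordinates: the space of
all formal sums of the vectors `f ^ i q ^ j v`, where `i` and `j` are integers. -/
@[nolint unusedArguments]
def LocalizedVerma (_l₁ _l₂ : ℂ) : Type := ℤ → ℤ → ℂ

namespace LocalizedVerma

variable {l₁ l₂ : ℂ}

instance : AddCommGroup (LocalizedVerma l₁ l₂) := inferInstanceAs (AddCommGroup (ℤ → ℤ → ℂ))
noncomputable instance : Module ℂ (LocalizedVerma l₁ l₂) := inferInstanceAs (Module ℂ (ℤ → ℤ → ℂ))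

variable (l₁ l₂) in
/-- The representation of the enveloping algebra on `LocalizedVerma l₁ l₂`. -/
noncomputable def rep : U →ₐ[ℂ] Module.End ℂ (LocalizedVerma l₁ l₂) :=
  UniversalEnvelopingAlgebra.lift ℂ (coeffAction l₁ l₂)

noncomputable instance : Module U (LocalizedVerma l₁ l₂) :=
  Module.compHom _ (rep l₁ l₂).toRingHom

instance : IsScalarTower ℂ U (LocalizedVerma l₁ l₂) where
  smul_assoc c u φ := LinearMap.congr_fun (map_smul (rep l₁ l₂) c u) φ

theorem toU_smul_apply (x : Sch) (φ : LocalizedVerma l₁ l₂) (i j : ℤ) :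
    (toU x • φ) i j =
      x.e * (l₂ * (j + 2) * (j + 1) / 2 * φ i (j + 2) + (i + 1) * (l₁ - j - i) * φ (i + 1) j) +
      x.h * ((l₁ - 2 * i - j) * φ i j) +
      x.f * φ (i - 1) j +
      x.p * ((j + 1) * l₂ * φ i (j + 1) - (i + 1) * φ (i + 1) (j - 1)) +
      x.q * φ i (j - 1) +
      x.z * (l₂ * φ i j) := by
  have h : rep l₁ l₂ (toU x) = coeffAction l₁ l₂ x :=
    UniversalEnvelopingAlgebra.lift_ι_apply ℂ _ x
  change rep l₁ l₂ (toU x) φ i j = _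
  rw [h]
  rfl

variable (l₁ l₂) in
/-- The action of `f` on `LocalizedVerma l₁ l₂`, as a unit. -/
def shift : (Module.End ℂ (LocalizedVerma l₁ l₂))ˣ where
  val :=
    { toFun := fun φ i j => φ (i - 1) j
      map_add' := fun _ _ => rfl
      map_smul' := fun _ _ => rfl }
  inv :=
    { toFun := fun φ i j => φ (i + 1) j
      map_add' := fun _ _ => rfl
      map_smul' := fun _ _ => rfl }
  val_inv := LinearMap.ext fun φ => funext₂ fun i j => congrArg (φ · j) (sub_add_cancel i 1)
  inv_val := LinearMap.ext fun φ => funext₂ fun i j => congrArg (φ · j) (add_sub_cancel_right i 1)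

theorem fU_smul_apply (φ : LocalizedVerma l₁ l₂) (i j : ℤ) : (fU • φ) i j = φ (i - 1) j := by
  simp only [fU, toU_smul_apply, zero_mul, one_mul, zero_add, add_zero]

theorem rep_fU : rep l₁ l₂ fU = shift l₁ l₂ :=
  LinearMap.ext fun φ => funext₂ fun i j => fU_smul_apply φ i j

variable (l₁ l₂) in
/-- The representation of `U_(f)` on `LocalizedVerma l₁ l₂`. -/
noncomputable def repUf : Uf →+* Module.End ℂ (LocalizedVerma l₁ l₂) :=
  OreLocalization.universalHom (rep l₁ l₂).toRingHom
    (IsUnit.liftRight ((rep l₁ l₂ : U →* _).comp (Submonoid.powers fU).subtype) <| by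
      rintro ⟨_, n, rfl⟩
      exact (map_pow (rep l₁ l₂) fU n).symm ▸ (rep_fU (l₁ := l₁) ▸ (shift l₁ l₂).isUnit).pow n)
    fun _ => rfl

theorem repUf_UtoUf (u : U) : repUf l₁ l₂ (UtoUf u) = rep l₁ l₂ u :=
  OreLocalization.universalHom_commutes (rep l₁ l₂).toRingHom _ fun _ => rfl

noncomputable instance : Module Uf (LocalizedVerma l₁ l₂) := Module.compHom _ (repUf l₁ l₂)

instance : IsScalarTower U Uf (LocalizedVerma l₁ l₂) where
  smul_assoc u x φ := by
    change repUf l₁ l₂ (u • x) φ = rep l₁ l₂ u (repUf l₁ l₂ x φ)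
    rw [smul_Uf, map_mul, repUf_UtoUf, Module.End.mul_apply]

instance : SMulCommClass Uf ℂ (LocalizedVerma l₁ l₂) where
  smul_comm x c φ := map_smul (repUf l₁ l₂ x) c φ

theorem qU_pow_smul_apply (k : ℕ) (φ : LocalizedVerma l₁ l₂) (i j : ℤ) :
    (qU ^ k • φ) i j = φ i (j - k) := by
  induction k generalizing j with
  | zero => simp
  | succ k ih =>
    rw [pow_succ', mul_smul, qU, toU_smul_apply]
    simp only [zero_mul, one_mul, zero_add, add_zero]
    rw [← qU, ih, Nat.cast_succ, sub_sub, add_comm (1 : ℤ)]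

theorem fUnit_inv_pow_smul_apply (k : ℕ) (φ : LocalizedVerma l₁ l₂) (i j : ℤ) :
    ((↑fUnit⁻¹ : Uf) ^ k • φ) i j = φ (i + k) j := by
  have hinv : repUf l₁ l₂ ↑fUnit⁻¹ = ↑(shift l₁ l₂)⁻¹ := by
    rw [← show Units.map (repUf l₁ l₂ : Uf →* _) fUnit = shift l₁ l₂ from
      Units.ext ((repUf_UtoUf fU).trans rep_fU)]
    rfl
  induction k generalizing i with
  | zero => simp
  | succ k ih =>
    have hstep (ψ : LocalizedVerma l₁ l₂) : ((↑fUnit⁻¹ : Uf) • ψ) i j = ψ (i + 1) j :=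
      congrFun₂ (LinearMap.congr_fun hinv ψ) i j
    rw [pow_succ', mul_smul, hstep, ih, Nat.cast_succ, add_assoc, add_comm (1 : ℤ)]

variable (l₁ l₂) in
/-- The highest weight vector `v`. -/
def vacuum : LocalizedVerma l₁ l₂ := fun i j => if i = 0 ∧ j = 0 then 1 else 0

theorem intCast_mul_vacuum (i j : ℤ) : (i : ℂ) * vacuum l₁ l₂ i j = 0 := by
  rw [vacuum, mul_ite, mul_zero, ite_eq_right_iff]
  rintro ⟨rfl, -⟩
  rw [Int.cast_zero, zero_mul]

theorem intCast_mul_vacuum' (i j : ℤ) : (j : ℂ) * vacuum l₁ l₂ i j = 0 := by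
  rw [vacuum, mul_ite, mul_zero, ite_eq_right_iff]
  rintro ⟨-, rfl⟩
  rw [Int.cast_zero, zero_mul]

theorem isHighestWeight_vacuum : IsHighestWeight l₁ l₂ (vacuum l₁ l₂) := by
  rintro ⟨x, hf, hq⟩
  funext i j
  change (toU x • vacuum l₁ l₂) i j = (l₁ * x.h + l₂ * x.z) * vacuum l₁ l₂ i j
  rw [toU_smul_apply, hf, hq]
  have h₁ := intCast_mul_vacuum (l₁ := l₁) (l₂ := l₂)
  have h₂ := intCast_mul_vacuum' (l₁ := l₁) (l₂ := l₂)
  have he := h₂ i (j + 2)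
  have he' := h₁ (i + 1) j
  have hp := h₂ i (j + 1)
  have hp' := h₁ (i + 1) (j - 1)
  push_cast at he he' hp hp'
  linear_combination x.e * (l₂ * (j + 1) / 2 * he + (l₁ - j - i) * he') -
    x.h * (2 * h₁ i j + h₂ i j) + x.p * (l₂ * hp - hp')

variable (l₁ l₂) in
/-- The formal sums of the vectors `f ^ i q ^ j v` with `i ≥ 0`. -/
def nonnegative : Submodule U (LocalizedVerma l₁ l₂) :=
  let N : Submodule ℂ (LocalizedVerma l₁ l₂) :=
    { carrier := {φ | ∀ i < 0, ∀ j, φ i j = 0}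
      zero_mem' := fun _ _ _ => rfl
      add_mem' := fun {φ ψ} hφ hψ i hi j => by
        change φ i j + ψ i j = 0
        rw [hφ i hi, hψ i hi, add_zero]
      smul_mem' := fun c φ hφ i hi j => by
        change c * φ i j = 0
        rw [hφ i hi, mul_zero] }
  { N with
    smul_mem' := fun u φ hφ => by
      refine smul_mem_of_toU_smul_mem (N := N) (fun x φ hφ i hi j => ?_) u hφ
      have hsucc (k : ℤ) : (i + 1 : ℂ) * φ (i + 1) k = 0 := by
        rcases (Int.add_one_le_iff.2 hi).lt_or_eq with h | h
        · rw [hφ _ h, mul_zero]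
        · rw [← Int.cast_one, ← Int.cast_add, h, Int.cast_zero, zero_mul]
      rw [toU_smul_apply, hφ i hi, hφ i hi, hφ i hi, hφ i hi, hφ (i - 1) (by lia)]
      linear_combination x.e * (l₁ - j - i) * hsucc j - x.p * hsucc (j - 1) }

theorem vacuum_mem_nonnegative : vacuum l₁ l₂ ∈ nonnegative l₁ l₂ :=
  fun _ hi _ => if_neg fun h => hi.ne h.1

theorem vermaLift_vacuum_mem_nonnegative (m : Verma l₁ l₂) :
    vermaLift isHighestWeight_vacuum m ∈ nonnegative l₁ l₂ := by
  obtain ⟨u, rfl⟩ := exists_smul_hwVec m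
  rw [map_smul, vermaLift_hwVec]
  exact Submodule.smul_mem _ u vacuum_mem_nonnegative

end LocalizedVerma

instance (l₁ l₂ : ℂ) : Nontrivial (Verma l₁ l₂) := by
  refine ⟨⟨hwVec l₁ l₂, 0, fun h => ?_⟩⟩
  have hv := congrArg (vermaLift LocalizedVerma.isHighestWeight_vacuum) h
  rw [vermaLift_hwVec, map_zero] at hv
  exact one_ne_zero ((if_pos ⟨rfl, rfl⟩).symm.trans (congrFun₂ hv 0 0))

end FormalModel

section FracLift

theorem UtoUf_smul {P : Type*} [AddCommGroup P] [Module U P] [Module Uf P] [IsScalarTower U Uf P]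
    (u : U) (y : P) : UtoUf u • y = u • y := by
  rw [← mul_one (UtoUf u), ← smul_Uf, smul_assoc, one_smul]

variable {M P : Type*} [AddCommGroup M] [Module ℂ M] [Module U M] [IsScalarTower ℂ U M]
  [AddCommGroup P] [Module ℂ P] [Module U P] [IsScalarTower ℂ U P] [Module Uf P]
  [IsScalarTower U Uf P] [SMulCommClass Uf ℂ P]

/-- The map `S_f ⊗_U M → P / P₀` induced by `φ : M → P` and the action of `U_(f)` on `P`. -/
noncomputable def fracLift (φ : M →ₗ[U] P) (P₀ : Submodule U P) (hφ : ∀ m, φ m ∈ P₀) :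
    BalancedTensor U U Sf M →ₗ[U] P ⧸ P₀ :=
  balancedLift
    (imageU.liftQ
      { toFun := fun x => (P₀.mkQ.restrictScalars ℂ).comp
          ((DistribSMul.toLinearMap ℂ P x).comp (φ.restrictScalars ℂ))
        map_add' := fun x y => LinearMap.ext fun m =>
          (congrArg P₀.mkQ (add_smul x y (φ m))).trans (map_add _ _ _)
        map_smul' := fun u x => LinearMap.ext fun m =>
          congrArg P₀.mkQ (smul_assoc u x (φ m)) } <| by
      intro x hx
      obtain ⟨u, rfl⟩ := mem_imageU.1 hx
      refine LinearMap.mem_ker.2 (LinearMap.ext fun m => (Submodule.Quotient.mk_eq_zero _).2 ?_)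
      change UtoUf u • φ m ∈ P₀
      rw [UtoUf_smul]
      exact P₀.smul_mem u (hφ m)) <| by
    intro x r m
    induction x using Submodule.Quotient.induction_on with | _ x =>
    refine congrArg P₀.mkQ (?_ : (x * UtoUf r) • φ m = x • φ (r • m))
    rw [mul_smul, UtoUf_smul, map_smul]

theorem fracLift_fracTensor (φ : M →ₗ[U] P) (P₀ : Submodule U P) (hφ : ∀ m, φ m ∈ P₀) (i : ℕ)
    (m : M) : fracLift φ P₀ hφ (fracTensor i m) =
      Submodule.Quotient.mk ((↑fUnit⁻¹ : Uf) ^ i • φ m) := rfl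

end FracLift

/-! ## Nonvanishing of `V(n, l₂)` -/

section SingularVector

/-- The coefficients `a_k` of `singularVector`: the recursion makes the terms of
`e • ∑ a_k f ^ (-k-1) ⊗ q ^ (2k+1) v` telescope when `l₁ = n - 1`. -/
noncomputable def singularCoeff (n : ℕ) (l₂ : ℂ) : ℕ → ℂ
  | 0 => 1
  | k + 1 => (n - k) / (l₂ * (2 * k + 3)) * singularCoeff n l₂ k

/-- A vector of the form `∑ a_k f ^ (-k-1) ⊗ q ^ (2k+1) v` in `S_f ⊗_U Δ(l₁, l₂)`, with
`v` the highest weight vector; it is killed by `e` when `l₁ = n - 1`. -/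
noncomputable def singularVector (n : ℕ) (l₁ l₂ : ℂ) : BalancedTensor U U Sf (Verma l₁ l₂) :=
  ∑ k ∈ Finset.range (n + 1),
    singularCoeff n l₂ k • fracTensor (k + 1) (qU ^ (2 * k + 1) • hwVec l₁ l₂)

theorem singularCoeff_succ_mul (n k : ℕ) {l₂ : ℂ} (hl₂ : l₂ ≠ 0) :
    singularCoeff n l₂ (k + 1) * (l₂ * (2 * k + 3)) = (n - k) * singularCoeff n l₂ k := by
  have h : 2 * (k : ℂ) + 3 ≠ 0 := mod_cast (by lia : 2 * k + 3 ≠ 0)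
  rw [singularCoeff, mul_right_comm, div_mul_cancel₀ _ (mul_ne_zero hl₂ h)]

theorem eU_smul_sum_singularCoeff (n m : ℕ) {l₂ : ℂ} (hl₂ : l₂ ≠ 0) :
    eU • ∑ k ∈ Finset.range (m + 1),
        singularCoeff n l₂ k • fracTensor (k + 1) (qU ^ (2 * k + 1) • hwVec (n - 1) l₂) =
      (-(singularCoeff n l₂ m * (m + 1) * (n - m))) •
        fracTensor (m + 2) (qU ^ (2 * m + 1) • hwVec (n - 1) l₂) := by
  have hw := isHighestWeight_hwVec (n - 1) l₂
  induction m with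
  | zero =>
    rw [zero_add, Finset.sum_range_one, smul_comm, eU_smul_fracTensor, hw.h_smul_q_pow,
      fracTensor_smul, mul_zero, zero_add, pow_one, hw.e_smul_q, fracTensor_zero]
    push_cast
    module
  | succ m ih =>
    rw [Finset.sum_range_succ, smul_add, ih, smul_comm eU, eU_smul_fracTensor, hw.h_smul_q_pow,
      fracTensor_smul, show 2 * (m + 1) + 1 = 2 * m + 1 + 2 by ring, hw.e_smul_q_pow_add_two,
      fracTensor_smul]
    have hrec := singularCoeff_succ_mul n m hl₂
    push_cast
    match_scalars
    · linear_combination (m + 1 : ℂ) * hrec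
    · ring

theorem eU_smul_singularVector (n : ℕ) {l₂ : ℂ} (hl₂ : l₂ ≠ 0) :
    eU • singularVector n (n - 1) l₂ = 0 := by
  rw [singularVector, eU_smul_sum_singularCoeff n n hl₂, sub_self, mul_zero, neg_zero, zero_smul]

open LocalizedVerma in
theorem singularVector_ne_zero (n : ℕ) (l₁ l₂ : ℂ) : singularVector n l₁ l₂ ≠ 0 := by
  intro h
  let coeff : LocalizedVerma l₁ l₂ →+ ℂ := ⟨⟨fun φ => φ (-1) 1, rfl⟩, fun _ _ => rfl⟩
  let φ (k : ℕ) : LocalizedVerma l₁ l₂ :=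
    singularCoeff n l₂ k • (↑fUnit⁻¹ : Uf) ^ (k + 1) • qU ^ (2 * k + 1) • vacuum l₁ l₂
  have hφ (k : ℕ) : coeff (φ k) = if k = 0 then 1 else 0 := by
    change singularCoeff n l₂ k * ((↑fUnit⁻¹ : Uf) ^ (k + 1) • (_ : LocalizedVerma l₁ l₂)) _ _ = _
    rw [fUnit_inv_pow_smul_apply, qU_pow_smul_apply, vacuum]
    rcases k with _ | k
    · simp [singularCoeff]
    · rw [if_neg (by lia), if_neg (by lia), mul_zero]
  have himage : fracLift _ _ vermaLift_vacuum_mem_nonnegative (singularVector n l₁ l₂) =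
      (nonnegative l₁ l₂).mkQ (∑ k ∈ Finset.range (n + 1), φ k) := by
    rw [singularVector, map_sum, map_sum]
    refine Finset.sum_congr rfl fun k _ => ?_
    rw [LinearMap.map_smul_of_tower, fracLift_fracTensor, map_smul, vermaLift_hwVec]
    rfl
  rw [h, map_zero] at himage
  have hcoeff : coeff (∑ k ∈ Finset.range (n + 1), φ k) = 0 :=
    (Submodule.Quotient.mk_eq_zero _).1 himage.symm (-1) (by norm_num) 1
  rw [map_sum] at hcoeff
  simp [hφ] at hcoeff

theorem singularVector_mem_locallyFinite (n : ℕ) {l₂ : ℂ} (hl₂ : l₂ ≠ 0) :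
    singularVector n (n - 1) l₂ ∈ locallyFinite (BalancedTensor U U Sf (Verma (n - 1) l₂)) := by
  refine (finite_orbitSpan_iff _).2 ⟨Submodule.span ℂ {singularVector n (n - 1) l₂}, inferInstance,
    Submodule.mem_span_singleton_self _, fun y hy => ?_⟩
  obtain ⟨c, rfl⟩ := Submodule.mem_span_singleton.1 hy
  rw [smul_comm, eU_smul_singularVector n hl₂, smul_zero]
  exact zero_mem _

theorem nontrivial_enAr_verma (n : ℕ) {l₂ : ℂ} (hl₂ : l₂ ≠ 0) :
    Nontrivial (EnAr (Verma (n - 1) l₂)) :=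
  ⟨⟨⟨_, singularVector_mem_locallyFinite n hl₂⟩, 0, fun h =>
    singularVector_ne_zero n _ l₂ (congrArg Subtype.val h)⟩⟩

end SingularVector

/-! ## The annihilators -/

section Annihilator

theorem half_integer_sq_ne (n m : ℕ) :
    ((m : ℂ) + 1) ^ 2 ≠ (n - 1) ^ 2 + 3 * (n - 1) + 9 / 4 := by
  intro h
  have h' : ((4 * (m + 1) ^ 2 : ℕ) : ℂ) = ((4 * n ^ 2 + 4 * n + 1 : ℕ) : ℂ) := by
    push_cast
    linear_combination 4 * h
  have := Nat.cast_injective h'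
  lia

theorem annihilator_verma {l₁ l₂ : ℂ} (hl₂ : l₂ ≠ 0)
    (hl₁ : ∀ m : ℕ, ((m : ℂ) + 1) ^ 2 ≠ l₁ ^ 2 + 3 * l₁ + 9 / 4) :
    Module.annihilator U (Verma l₁ l₂) = centralIdeal l₂ (l₁ ^ 2 + 3 * l₁) :=
  annihilator_eq_centralIdeal hl₂ hl₁ <|
    Ideal.span_le.2 (centralGenerators_subset_annihilator_verma l₁ l₂)

theorem annihilator_enAr_verma {l₁ l₂ : ℂ} (hl₂ : l₂ ≠ 0)
    (hl₁ : ∀ m : ℕ, ((m : ℂ) + 1) ^ 2 ≠ l₁ ^ 2 + 3 * l₁ + 9 / 4) [Nontrivial (EnAr (Verma l₁ l₂))] :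
    Module.annihilator U (EnAr (Verma l₁ l₂)) = centralIdeal l₂ (l₁ ^ 2 + 3 * l₁) :=
  annihilator_eq_centralIdeal hl₂ hl₁ <| Ideal.span_le.2 fun _ hx =>
    mem_annihilator_enAr (centralGenerators_subset_center _ _ hx)
      (centralGenerators_subset_annihilator_verma l₁ l₂ hx)

end Annihilator

end Schroedinger

theorem corollary5p18 (n : ℕ) (l₂ : ℂ) (hl₂ : l₂ ≠ 0) :
    Module.annihilator Schroedinger.U (Schroedinger.V n l₂) =
        Module.annihilator Schroedinger.U (Schroedinger.Verma (n - 1) l₂) ∧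
      Module.annihilator Schroedinger.U (Schroedinger.Verma (n - 1) l₂) =
        Module.annihilator Schroedinger.U (Schroedinger.Verma (-n - 2) l₂) ∧
      Schroedinger.IsCentrallyGenerated
        (Module.annihilator Schroedinger.U (Schroedinger.V n l₂)) := by
  have hcas : (-n - 2 : ℂ) ^ 2 + 3 * (-n - 2) = (n - 1) ^ 2 + 3 * (n - 1) := by ring
  have hne := Schroedinger.half_integer_sq_ne n
  have hweight : (if 0 ≤ (n : ℤ) then ((n : ℤ) : ℂ) - 1 else ((n : ℤ) : ℂ) - 2) = n - 1 := by simp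
  have := Schroedinger.nontrivial_enAr_verma n hl₂
  have hEnAr := Schroedinger.annihilator_enAr_verma hl₂ hne
  have hVerma := Schroedinger.annihilator_verma hl₂ hne
  have hVerma' := Schroedinger.annihilator_verma (l₁ := -n - 2) hl₂ (hcas ▸ hne)
  rw [hcas] at hVerma'
  unfold Schroedinger.V
  rw [hweight, hEnAr, hVerma, hVerma']
  exact ⟨rfl, rfl, Schroedinger.isCentrallyGenerated_centralIdeal _ _⟩
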